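/- Let $G$ be a finitely generated group and let $N=(N_i)_{i\ge 1}$ be an N-series of $G$, that is, a descending chain of subgroups $G=N_1\ge N_2\ge N_3\ge\cdots$ such that $[N_i,N_j]\subset N_{i+j}$ for all $i,j\ge 1$. Assume that $N_{d+1}=\{1\}$ for some integer $d\ge 0$. For a prime number $p$, let the $p$-exponent $e(p)$ of $G$ be the smallest integer $e\ge 0$ such that $x^{p^{e}}=1$ for every $x\in G$ whose order is a (finite) power of $p$, with $e(p)=\infty$ if there is no such $e$. For $i\ge 1$, let $\Delta_i(N;\mathbb{Z})$ be the additive subgroup of the group ring $\mathbb{Z}[G]$ generated by all the products $(g_1-1)\cdots(g_r-1)$ with $r\ge 1$, $g_1\in N_{k_1},\dots,g_r\in N_{k_r}$, where $k_1,\dots,k_r\ge 1$ and $k_1+\cdots+k_r\ge i$. The $i$-th dimension subgroup of $G$ defined by $N$ with coefficients in $\mathbb{Z}$ is $$D_i(N;\mathbb{Z})=\{g\in G : g-1\in\Delta_i(N;\mathbb{Z})\}.$$ Then the maximum $$m:=\max\{\,p^{e(p)} : p \text{ a prime number}\,\}$$ exists and is finite, and the dimension subgroup $D_{m^{d}(d+1)}(N;\mathbb{Z})$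 is trivial. -/

import Mathlib

/-- An N-series of a group `G`: a descending chain of subgroups `G = N₁ ≥ N₂ ≥ N₃ ≥ ⋯` such that
`[Nᵢ, Nⱼ] ≤ Nᵢ₊ⱼ` for all `i, j ≥ 1`. The terms are indexed by the positive integers; the value
`N 0` is a dummy value that is not used anywhere. -/
structure IsNSeries {G : Type*} [Group G] (N : ℕ → Subgroup G) : Prop where
  one_eq_top : N 1 = ⊤
  succ_le : ∀ i, 1 ≤ i → N (i + 1) ≤ N i
  commutator_le : ∀ i j, 1 ≤ i → 1 ≤ j → ⁅N i, N j⁆ ≤ N (i + j)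

/-- The `i`-th term of the filtration of the augmentation ideal of `R[G]` that is induced by `N`:
the `R`-submodule spanned by the products `(g₁ - 1) ⋯ (gᵣ - 1)` with `g₁ ∈ N k₁, …, gᵣ ∈ N kᵣ`
for positive integers `k₁, …, kᵣ` such that `k₁ + ⋯ + kᵣ ≥ i`. A product of this kind
is recorded by the list of the pairs `(k₁, g₁), …, (kᵣ, gᵣ)`, with `r ≥ 1`. -/
noncomputable def nSeriesFiltration (R : Type*) [CommRing R] {G : Type*} [Group G] (N : ℕ → Subgroup G)
    (i : ℕ) : Submodule R (MonoidAlgebra R G) :=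
  Submodule.span R
    {x | ∃ l : List (ℕ × G), l ≠ [] ∧ (∀ q ∈ l, 1 ≤ q.1 ∧ q.2 ∈ N q.1) ∧
      i ≤ (l.map fun q => q.1).sum ∧
      x = (l.map fun q => MonoidAlgebra.of R G q.2 - 1).prod}

theorem mul_of_mem_nSeriesFiltration {R : Type*} [CommRing R] {G : Type*} [Group G]
    {N : ℕ → Subgroup G} (hN : IsNSeries N) (i : ℕ) {x : MonoidAlgebra R G}
    (hx : x ∈ nSeriesFiltration R N i) (h : G) :
    x * MonoidAlgebra.of R G h ∈ nSeriesFiltration R N i := by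
  unfold nSeriesFiltration at hx
  induction hx using Submodule.span_induction with
  | mem x hx =>
    obtain ⟨l, hne, hl, hi, rfl⟩ := hx
    have h1 : (l.map fun q => MonoidAlgebra.of R G q.2 - 1).prod
        ∈ nSeriesFiltration R N i :=
      Submodule.subset_span ⟨l, hne, hl, hi, rfl⟩
    have h2 : (l.map fun q => MonoidAlgebra.of R G q.2 - 1).prod *
        (MonoidAlgebra.of R G h - 1) ∈ nSeriesFiltration R N i := by
      refine Submodule.subset_span ⟨l ++ [(1, h)], by simp, ?_, ?_, by simp⟩
      · intro q hq
        rcases List.mem_append.1 hq with hq | hq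
        · exact hl q hq
        · obtain rfl := List.mem_singleton.1 hq
          exact ⟨le_rfl, by simp [hN.one_eq_top]⟩
      · simp only [List.map_append, List.sum_append]
        omega
    have h3 := Submodule.add_mem _ h2 h1
    rwa [mul_sub, mul_one, sub_add_cancel] at h3
  | zero => rw [zero_mul]; exact Submodule.zero_mem _
  | add x y _ _ ihx ihy => rw [add_mul]; exact Submodule.add_mem _ ihx ihy
  | smul a x _ ih => rw [smul_mul_assoc]; exact Submodule.smul_mem _ a ih

/-- The `i`-th dimension subgroup `Dᵢ(N; R) = G ∩ (1 + Δᵢ(N; R))` of `G` defined by the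
N-series `N`, with coefficients in `R`. -/
noncomputable def dimensionSubgroup (R : Type*) [CommRing R] {G : Type*} [Group G] {N : ℕ → Subgroup G}
    (hN : IsNSeries N) (i : ℕ) : Subgroup G where
  carrier := {g | MonoidAlgebra.of R G g - 1 ∈ nSeriesFiltration R N i}
  one_mem' := by
    have h : MonoidAlgebra.of R G 1 - 1 = 0 := by rw [map_one, sub_self]
    rw [Set.mem_ofPred_eq, h]
    exact Submodule.zero_mem _
  mul_mem' := by
    intro a b ha hb
    have h := Submodule.add_mem _ (mul_of_mem_nSeriesFiltration hN i ha b) hb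
    rw [sub_mul, one_mul, sub_add_sub_cancel, ← map_mul] at h
    exact h
  inv_mem' := by
    intro a ha
    have h := Submodule.neg_mem _ (mul_of_mem_nSeriesFiltration hN i ha a⁻¹)
    rw [sub_mul, one_mul, ← map_mul, mul_inv_cancel, map_one, neg_sub] at h
    exact h

/-- The `p`-exponent of `G`: the smallest `e` such that `x ^ (p ^ e) = 1` for every element `x` of
`G` whose order is a power of `p`, and `⊤` if there is no such `e`. -/
noncomputable def pExponent (G : Type*) [Group G] (p : ℕ) : ℕ∞ :=
  ⨅ (e : ℕ) (_ : ∀ x : G, (∃ k : ℕ, x ^ p ^ k = 1) → x ^ p ^ e = 1), (e : ℕ∞)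

/-! ### Abelian sections, and commutators of powers modulo a normal subgroup. -/

open scoped commutatorElement

universe u

/-! Since `N (d + 1) = ⊥`, the group is finitely generated nilpotent. Its torsion elements therefore
have a common exponent `E`, so every `p ^ e(p)` is at most `E` and the maximum `m` exists.

The rest compares `N` with larger N-series `M` whose dimension subgroups over a suitable `R` are the
terms of `M` themselves. This holds over `ℤ` if the factors `M w / M (w + 1)` are torsion-free, and
over `ZMod p` if `M` is restricted, i.e. `x ^ p ∈ M (p * i)` for `x ∈ M i`. In both cases one climbs
from `M (w + 1)` to `M w` one coordinate at a time. If `K` is the kernel of an additive coordinate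
`t` on `H` and `t x = 1`, elements of the filtration of `R[H]` expand in powers of `x - 1` with
coefficients in `R[K]`. The constant and linear coefficients of `h - 1` then force `t h = 0` and
reduce the claim to `K`.

Over `ℤ`, the isolator series (elements with a positive power in `N i`) shows that a dimension
subgroup of index at least `d + 1` is torsion. Over `ZMod p`, a restricted series built from
`pSeries` shows that an element `g` of the dimension subgroup of index `n` is a product of powers `x
^ p ^ a` with `x ∈ N i` and `i + a ≥ 1 + clog p n`. For `n ≥ m ^ d * (d + 1)` such products turn out
to be single powers `z ^ p ^ e(p)` (when `d` and `e(p)` are positive). If also `g ^ p = 1`, then `z`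
has `p`-power order, so `g = z ^ p ^ e(p) = 1`. A torsion subgroup without elements of prime order
is trivial. -/

open Subgroup in
theorem exists_hom_commGroup {G : Type u} [Group G] {A B : Subgroup G} (h : ⁅A, A⁆ ≤ B) :
    ∃ (Q : Type u) (_ : CommGroup Q) (f : A →* Q),
      Function.Surjective f ∧ ∀ a : A, f a = 1 ↔ (a : G) ∈ B := by
  have hn : (B.subgroupOf A).Normal := by
    refine ⟨fun b hb a => ?_⟩
    rw [mem_subgroupOf] at hb ⊢
    have h1 := B.mul_mem (h (commutator_mem_commutator a.2 b.2)) hb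
    simpa [commutatorElement_def] using h1
  have hc : ∀ x y : A ⧸ B.subgroupOf A, x * y = y * x := by
    intro x y
    obtain ⟨x, rfl⟩ := QuotientGroup.mk_surjective x
    obtain ⟨y, rfl⟩ := QuotientGroup.mk_surjective y
    change ((x * y : A) : A ⧸ B.subgroupOf A) = ((y * x : A) : A ⧸ B.subgroupOf A)
    rw [QuotientGroup.eq, mem_subgroupOf]
    have h1 := h (commutator_mem_commutator (A.inv_mem y.2) (A.inv_mem x.2))
    simpa [commutatorElement_def, mul_assoc] using h1
  exact ⟨A ⧸ B.subgroupOf A, CommGroup.mk hc, QuotientGroup.mk' _,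
    QuotientGroup.mk'_surjective _, fun a => (QuotientGroup.eq_one_iff a).trans mem_subgroupOf⟩

theorem commutatorElement_pow_left {G : Type*} [Group G] {u v : G} (h : Commute ⁅u, v⁆ u) (n : ℕ) :
    ⁅u ^ n, v⁆ = ⁅u, v⁆ ^ n := by
  induction n with
  | zero => simp
  | succ n ih =>
    rw [pow_succ' u, commutatorElement_mul_left_eq_conj_mul, ih,
      ← (h.pow_left n).eq, mul_inv_cancel_right, pow_succ]

theorem mk_commutatorElement_pow_left {G : Type*} [Group G] {B : Subgroup G} [B.Normal]
    {u v : G} (h : ⁅⁅u, v⁆, u⁆ ∈ B) (n : ℕ) :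
    QuotientGroup.mk' B ⁅u ^ n, v⁆ = QuotientGroup.mk' B (⁅u, v⁆ ^ n) := by
  have h1 : Commute ⁅QuotientGroup.mk' B u, QuotientGroup.mk' B v⁆ (QuotientGroup.mk' B u) := by
    rw [← commutatorElement_eq_one_iff_commute, ← map_commutatorElement, ← map_commutatorElement]
    exact (QuotientGroup.eq_one_iff _).2 h
  have h2 := commutatorElement_pow_left h1 n
  rwa [← map_commutatorElement, ← map_pow, ← map_commutatorElement, ← map_pow] at h2

theorem commutatorElement_pow_left_mem_iff {G : Type*} [Group G] {B : Subgroup G} [B.Normal]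
    {u v : G} (h : ⁅⁅u, v⁆, u⁆ ∈ B) (n : ℕ) : ⁅u ^ n, v⁆ ∈ B ↔ ⁅u, v⁆ ^ n ∈ B := by
  have h2 := mk_commutatorElement_pow_left h n
  rw [← QuotientGroup.eq_one_iff, ← QuotientGroup.eq_one_iff]
  exact ⟨fun h3 => h2.symm.trans h3, fun h3 => h2.trans h3⟩

theorem mul_pow_inv_mul_mem {G : Type*} [Group G] {B : Subgroup G} [B.Normal] {x y : G}
    (h : ⁅x, y⁆ ∈ B) (n : ℕ) : ((x * y) ^ n)⁻¹ * (x ^ n * y ^ n) ∈ B := by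
  have h1 : Commute (QuotientGroup.mk' B x) (QuotientGroup.mk' B y) := by
    rw [← commutatorElement_eq_one_iff_commute, ← map_commutatorElement]
    exact (QuotientGroup.eq_one_iff _).2 h
  have h2 := h1.mul_pow n
  rw [← QuotientGroup.eq]
  simpa using h2

theorem exists_isolator_subgroup {G : Type*} [Group G] {A B : Subgroup G} (h : ⁅A, A⁆ ≤ B) :
    ∃ U : Subgroup G, ∀ u, u ∈ U ↔ u ∈ A ∧ ∃ k, 0 < k ∧ u ^ k ∈ B := by
  obtain ⟨Q, _, f, -, hf⟩ := exists_hom_commGroup h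
  have key : ∀ (u : A) (k : ℕ), (u : G) ^ k ∈ B ↔ f u ^ k = 1 := by
    intro u k
    rw [← map_pow, hf]
    simp
  refine ⟨{ carrier := {u | u ∈ A ∧ ∃ k, 0 < k ∧ u ^ k ∈ B}
            one_mem' := ⟨A.one_mem, 1, one_pos, by simp⟩
            mul_mem' := ?_
            inv_mem' := ?_ }, fun u => Iff.rfl⟩
  · rintro u v ⟨hu, k, hk, hku⟩ ⟨hv, l, hl, hlv⟩
    refine ⟨A.mul_mem hu hv, k * l, Nat.mul_pos hk hl, ?_⟩
    have h1 := (key ⟨u, hu⟩ k).1 hku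
    have h2 := (key ⟨v, hv⟩ l).1 hlv
    refine (key (⟨u, hu⟩ * ⟨v, hv⟩) (k * l)).2 ?_
    rw [map_mul, mul_pow, pow_mul, h1, one_pow, mul_comm k, pow_mul, h2, one_pow, one_mul]
  · rintro u ⟨hu, k, hk, hku⟩
    exact ⟨A.inv_mem hu, k, hk, by rw [inv_pow]; exact B.inv_mem hku⟩

/-! ### Torsion in nilpotent groups. -/

namespace Subgroup

variable {G : Type*} [Group G]

theorem commutator_closure_le {S T : Set G} {B : Subgroup G} [B.Normal]
    (h : ∀ s ∈ S, ∀ t ∈ T, ⁅s, t⁆ ∈ B) : ⁅closure S, closure T⁆ ≤ B := by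
  have h1 : ∀ u ∈ closure S, ∀ v ∈ closure T,
      Commute (QuotientGroup.mk' B u) (QuotientGroup.mk' B v) := by
    intro u hu
    induction hu using closure_induction with
    | mem u hu =>
      intro v hv
      induction hv using closure_induction with
      | mem v hv =>
        rw [← commutatorElement_eq_one_iff_commute, ← map_commutatorElement]
        exact (QuotientGroup.eq_one_iff _).2 (h u hu v hv)
      | one => rw [map_one]; exact Commute.one_right _
      | mul v w _ _ hv hw => rw [map_mul]; exact hv.mul_right hw
      | inv v _ hv => rw [map_inv]; exact hv.inv_right
    | one => intro v _; rw [map_one]; exact Commute.one_left _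
    | mul u w _ _ hu hw => intro v hv; rw [map_mul]; exact (hu v hv).mul_left (hw v hv)
    | inv u _ hu => intro v hv; rw [map_inv]; exact (hu v hv).inv_left
  refine commutator_le.2 fun u hu v hv => ?_
  have h2 := commutatorElement_eq_one_iff_commute.2 (h1 u hu v hv)
  rw [← map_commutatorElement] at h2
  exact (QuotientGroup.eq_one_iff _).1 h2

/-- The lower central series of the whole group. -/
local notation "γ" => lowerCentralSeries (⊤ : Subgroup G)

theorem commutator_top_lowerCentralSeries_self_le (i : ℕ) : ⁅γ i, γ i⁆ ≤ γ (i + 1) :=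
  commutator_mono le_rfl le_top

/-- Modulo `γ (i + 2)` one has `⁅x, g⁆ ^ k = ⁅x ^ k, g⁆`, so torsion of one factor of the series
passes to the next. -/
theorem exists_pow_mem_lowerCentralSeries_succ {i : ℕ}
    (h : ∀ x ∈ γ i, ∃ k, 0 < k ∧ x ^ k ∈ γ (i + 1)) :
    ∀ x ∈ γ (i + 1), ∃ k, 0 < k ∧ x ^ k ∈ γ (i + 2) := by
  obtain ⟨U, hU⟩ := exists_isolator_subgroup
    (commutator_top_lowerCentralSeries_self_le (G := G) (i + 1))
  have hle : γ (i + 1) ≤ U := by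
    refine commutator_le.2 fun x hx g hg => (hU _).2 ?_
    have hc : ⁅x, g⁆ ∈ γ (i + 1) := commutator_mem_commutator hx hg
    obtain ⟨k, hk, hkx⟩ := h x hx
    refine ⟨hc, k, hk, (commutatorElement_pow_left_mem_iff ?_ k).1 ?_⟩
    · exact commutator_mem_commutator hc (mem_top x)
    · exact commutator_mem_commutator hkx hg
  exact fun x hx => ((hU x).1 (hle hx)).2

theorem exists_pow_eq_one_of_mem_lowerCentralSeries [Group.IsNilpotent G] {i : ℕ}
    (h : ∀ x ∈ γ i, ∃ k, 0 < k ∧ x ^ k ∈ γ (i + 1)) :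
    ∀ x ∈ γ i, ∃ k, 0 < k ∧ x ^ k = 1 := by
  have h1 : ∀ j, ∀ x ∈ γ (i + j), ∃ k, 0 < k ∧ x ^ k ∈ γ (i + j + 1) := by
    intro j
    induction j with
    | zero => exact h
    | succ j ih => exact exists_pow_mem_lowerCentralSeries_succ ih
  have h2 : ∀ j, ∀ x ∈ γ i, ∃ k, 0 < k ∧ x ^ k ∈ γ (i + j) := by
    intro j x hx
    induction j with
    | zero => exact ⟨1, one_pos, by simpa using hx⟩
    | succ j ih =>
      obtain ⟨k, hk, hkx⟩ := ih
      obtain ⟨l, hl, hlx⟩ := h1 j _ hkx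
      exact ⟨k * l, Nat.mul_pos hk hl, by rw [pow_mul]; exact hlx⟩
  obtain ⟨n, hn⟩ := Subgroup.nilpotent_iff_lowerCentralSeries.1 (inferInstance : Group.IsNilpotent G)
  intro x hx
  obtain ⟨k, hk, hkx⟩ := h2 n x hx
  refine ⟨k, hk, ?_⟩
  have h3 := lowerCentralSeries_antitone (⊤ : Subgroup G) (Nat.le_add_left n i) hkx
  rwa [hn, mem_bot] at h3

theorem exists_mul_pow_eq_one_of_closure_pair [Group.IsNilpotent G] {x y : G}
    (hxy : closure {x, y} = ⊤) {a b : ℕ} (ha : 0 < a) (hb : 0 < b) (hx : x ^ a = 1)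
    (hy : y ^ b = 1) (z : G) : ∃ k, 0 < k ∧ z ^ k = 1 := by
  refine exists_pow_eq_one_of_mem_lowerCentralSeries (i := 0) ?_ z (mem_top z)
  obtain ⟨U, hU⟩ := exists_isolator_subgroup (commutator_top_lowerCentralSeries_self_le (G := G) 0)
  have hle : (⊤ : Subgroup G) ≤ U := by
    rw [← hxy, closure_le]
    rintro _ (rfl | rfl)
    · exact (hU _).2 ⟨mem_top _, a, ha, by rw [hx]; exact one_mem _⟩
    · exact (hU _).2 ⟨mem_top _, b, hb, by rw [hy]; exact one_mem _⟩
  exact fun z hz => ((hU z).1 (hle hz)).2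

/-- With only two generators, `γ 1` is generated modulo `γ 2` by `⁅x, y⁆`, and `⁅x, y⁆ ^ (a * b)` is
congruent to `⁅x ^ a, y ^ b⁆ = 1`. So `γ 1 / γ 2` is torsion, and hence so is `γ 1`. -/
theorem exists_commutator_pow_eq_one_of_closure_pair [Group.IsNilpotent G] {x y : G}
    (hxy : closure {x, y} = ⊤) {a b : ℕ} (ha : 0 < a) (hb : 0 < b) (h : Commute (x ^ a) (y ^ b)) :
    ∃ k, 0 < k ∧ ⁅x, y⁆ ^ k = 1 := by
  have hc : ∀ u v : G, ⁅u, v⁆ ∈ γ 1 := fun u v => commutator_mem_commutator (mem_top u) (mem_top v)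
  have hc2 : ∀ u v w : G, ⁅⁅u, v⁆, w⁆ ∈ γ 2 := fun u v w =>
    commutator_mem_commutator (hc u v) (mem_top w)
  refine exists_pow_eq_one_of_mem_lowerCentralSeries (i := 1) ?_ _ (hc x y)
  obtain ⟨U, hU⟩ := exists_isolator_subgroup (commutator_top_lowerCentralSeries_self_le (G := G) 1)
  have hγU : γ 2 ≤ U := fun z hz =>
    (hU z).2 ⟨lowerCentralSeries_antitone _ (by omega : 1 ≤ 2) hz, 1, one_pos, by simpa using hz⟩
  have hn : U.Normal := by
    refine ⟨fun z hz g => ?_⟩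
    have h1 : ⁅g, z⁆ ∈ γ 2 := by
      have := inv_mem (commutator_mem_commutator ((hU z).1 hz).1 (mem_top g))
      rwa [commutatorElement_inv] at this
    have h2 := mul_mem (hγU h1) hz
    simpa [commutatorElement_def] using h2
  have hxyU : ⁅x, y⁆ ∈ U := by
    refine (hU _).2 ⟨hc x y, a * b, Nat.mul_pos ha hb, ?_⟩
    have h1 : ⁅y ^ b, x ^ a⁆ ∈ γ 2 := by
      rw [commutatorElement_eq_one_iff_commute.2 h.symm]; exact one_mem _
    have h2 := (commutatorElement_pow_left_mem_iff (hc2 _ _ _) b).1 h1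
    rw [← inv_mem_iff, ← inv_pow, commutatorElement_inv] at h2
    rw [pow_mul, ← QuotientGroup.eq_one_iff]
    change QuotientGroup.mk' (γ 2) _ = 1
    rw [map_pow, ← mk_commutatorElement_pow_left (hc2 _ _ _), ← map_pow]
    exact (QuotientGroup.eq_one_iff _).2 h2
  have hle : γ 1 ≤ U := by
    have h1 : ⁅closure {x, y}, closure {x, y}⁆ ≤ U := by
      refine commutator_closure_le fun u hu v hv => ?_
      rcases hu with rfl | rfl <;> rcases hv with rfl | rfl
      · rw [commutatorElement_self]; exact one_mem _
      · exact hxyU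
      · rw [← commutatorElement_inv]; exact inv_mem hxyU
      · rw [commutatorElement_self]; exact one_mem _
    rwa [hxy] at h1
  exact fun z hz => ((hU z).1 (hle hz)).2

theorem closure_pair_subtype_eq_top (x y : G) :
    closure {(⟨x, subset_closure (Set.mem_insert _ _)⟩ : closure {x, y}),
      ⟨y, subset_closure (Set.mem_insert_of_mem _ rfl)⟩} = ⊤ := by
  rw [eq_top_iff, ← map_le_map_iff_of_injective (closure {x, y}).subtype_injective,
    MonoidHom.map_closure, Set.image_pair, ← MonoidHom.range_eq_map, range_subtype]
  rfl

end Subgroup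

theorem exists_mul_pow_eq_one_of_isNilpotent {G : Type*} [Group G] [Group.IsNilpotent G] {x y : G}
    {a b : ℕ} (ha : 0 < a) (hb : 0 < b) (hx : x ^ a = 1) (hy : y ^ b = 1) :
    ∃ k, 0 < k ∧ (x * y) ^ k = 1 := by
  obtain ⟨k, hk, h⟩ := Subgroup.exists_mul_pow_eq_one_of_closure_pair
    (Subgroup.closure_pair_subtype_eq_top x y) ha hb (Subtype.ext hx) (Subtype.ext hy)
    (⟨x, Subgroup.subset_closure (Set.mem_insert _ _)⟩ *
      ⟨y, Subgroup.subset_closure (Set.mem_insert_of_mem _ rfl)⟩)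
  exact ⟨k, hk, congrArg Subtype.val h⟩

theorem exists_commutator_pow_eq_one_of_isNilpotent {G : Type*} [Group G] [Group.IsNilpotent G]
    {x y : G} {a b : ℕ} (ha : 0 < a) (hb : 0 < b) (h : Commute (x ^ a) (y ^ b)) :
    ∃ k, 0 < k ∧ ⁅x, y⁆ ^ k = 1 := by
  obtain ⟨k, hk, h⟩ := Subgroup.exists_commutator_pow_eq_one_of_closure_pair
    (Subgroup.closure_pair_subtype_eq_top x y) ha hb (Subtype.ext h)
  exact ⟨k, hk, congrArg Subtype.val h⟩

/-! ### Finite generation, coordinates on abelian sections, and the exponent of the torsion. -/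

namespace Subgroup

variable {G : Type u} [Group G]

/-- The lower central series of the whole group. -/
local notation "γ" => lowerCentralSeries (⊤ : Subgroup G)

theorem fg_of_commGroup {Q : Type*} [CommGroup Q] [Group.FG Q] (P : Subgroup Q) : P.FG := by
  have : Module.Finite ℤ (Additive Q) := Module.Finite.iff_addGroup_fg.2 inferInstance
  rw [fg_iff_add_fg, ← AddSubgroup.toIntSubmodule_toAddSubgroup P.toAddSubgroup,
    ← Submodule.fg_iff_addSubgroup_fg]
  exact IsNoetherian.noetherian _

theorem fg_of_inf_fg {A B H : Subgroup G} (h : ⁅A, A⁆ ≤ B) {S : Set G} (hS : S.Finite)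
    (hSA : S ⊆ A) (hA : A ≤ closure S ⊔ B) (hBA : B ≤ A) (hHA : H ≤ A) (hHB : (H ⊓ B).FG) :
    H.FG := by
  classical
  obtain ⟨Q, _, f, hfs, hf⟩ := exists_hom_commGroup h
  have hQ : Group.FG Q := by
    refine Group.fg_iff.2 ⟨f '' (((↑) : A → G) ⁻¹' S), ?_,
      (hS.preimage Subtype.val_injective.injOn).image f⟩
    have h1 : A ≤ ((closure (f '' (((↑) : A → G) ⁻¹' S))).comap f).map A.subtype := by
      refine hA.trans (sup_le ?_ ?_)
      · rw [closure_le]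
        exact fun s hs => ⟨⟨s, hSA hs⟩, subset_closure ⟨⟨s, hSA hs⟩, hs, rfl⟩, rfl⟩
      · refine fun b hb => ⟨⟨b, hBA hb⟩, ?_, rfl⟩
        change f _ ∈ closure _
        rw [(hf _).2 hb]
        exact one_mem _
    rw [eq_top_iff]
    intro q _
    obtain ⟨a, rfl⟩ := hfs q
    obtain ⟨a', ha', he⟩ := h1 a.2
    obtain rfl : a' = a := Subtype.ext he
    exact ha'
  obtain ⟨T, hT⟩ := fg_of_commGroup ((H.subgroupOf A).map f)
  have hT1 : (T : Set Q) ⊆ f '' (H.subgroupOf A : Set A) := by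
    rw [← coe_map, ← hT]; exact subset_closure
  obtain ⟨T', hT'H, rfl⟩ := Finset.subset_set_image_iff.1 hT1
  have h2 : H = closure (((↑) : A → G) '' (T' : Set A)) ⊔ (H ⊓ B) := by
    refine le_antisymm (fun x hx => ?_) (sup_le ?_ inf_le_left)
    · have h3 : f ⟨x, hHA hx⟩ ∈ (closure (T' : Set A)).map f := by
        rw [MonoidHom.map_closure, ← Finset.coe_image, hT]
        exact ⟨⟨x, hHA hx⟩, hx, rfl⟩
      obtain ⟨y, hy, hyx⟩ := h3
      have hyH : (y : G) ∈ H := (closure_le (H.subgroupOf A)).2 hT'H hy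
      have h4 : (y : G)⁻¹ * x ∈ B := (hf (y⁻¹ * ⟨x, hHA hx⟩)).1 (by
        rw [map_mul, map_inv, hyx, inv_mul_cancel])
      have h5 : (y : G) ∈ closure (((↑) : A → G) '' (T' : Set A)) := by
        have := mem_map_of_mem A.subtype hy
        rwa [MonoidHom.map_closure] at this
      rw [← mul_inv_cancel_left (y : G) x]
      exact mul_mem_sup h5 ⟨H.mul_mem (H.inv_mem hyH) hx, h4⟩
    · rw [closure_le]
      rintro _ ⟨a, ha, rfl⟩
      exact hT'H ha
  rw [h2]
  refine FG.sup ?_ hHB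
  exact (fg_iff _).2 ⟨_, rfl, T'.finite_toSet.image _⟩

theorem exists_finite_closure_sup_lowerCentralSeries [Group.FG G] (i : ℕ) :
    ∃ S : Set G, S.Finite ∧ S ⊆ γ i ∧ γ i ≤ closure S ⊔ γ (i + 1) := by
  obtain ⟨S₀, hS₀, hS₀f⟩ := Group.fg_iff.1 (inferInstance : Group.FG G)
  induction i with
  | zero => exact ⟨S₀, hS₀f, fun _ _ => mem_top _, by rw [hS₀]; exact le_sup_left⟩
  | succ i ih =>
    obtain ⟨S, hSf, hS, hγ⟩ := ih
    have hS' : Set.image2 (fun a b => ⁅a, b⁆) S S₀ ⊆ γ (i + 1) := by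
      rintro _ ⟨a, ha, b, -, rfl⟩
      exact commutator_mem_commutator (hS ha) (mem_top b)
    refine ⟨Set.image2 (fun a b => ⁅a, b⁆) S S₀, hSf.image2 _ hS₀f, hS', ?_⟩
    set Q := closure (Set.image2 (fun a b => ⁅a, b⁆) S S₀) ⊔ γ (i + 2)
    have hQγ : Q ≤ γ (i + 1) :=
      sup_le ((closure_le _).2 hS') (lowerCentralSeries_antitone _ (Nat.le_succ _))
    have hn : Q.Normal := by
      refine ⟨fun z hz g => ?_⟩
      have h1 : ⁅z, g⁆ ∈ γ (i + 2) := commutator_mem_commutator (hQγ hz) (mem_top g)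
      have h2 : ⁅g, z⁆ ∈ Q := by
        rw [← commutatorElement_inv]; exact inv_mem (le_sup_right (a := closure _) h1)
      simpa [commutatorElement_def] using mul_mem h2 hz
    -- Modulo `Q` the elements of `S` commute with generators of `G`, and `γ (i + 1)` is central as
    -- well; hence the image of `γ i` is central, which says `⁅γ i, ⊤⁆ ≤ Q`.
    have hcen : γ i ≤ (center (G ⧸ Q)).comap (QuotientGroup.mk' Q) := by
      have hcom : ∀ a b : G, ⁅a, b⁆ ∈ Q →
          QuotientGroup.mk' Q b * QuotientGroup.mk' Q a
            = QuotientGroup.mk' Q a * QuotientGroup.mk' Q b := by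
        intro a b h1
        have h2 := (QuotientGroup.eq_one_iff _).2 h1
        change QuotientGroup.mk' Q ⁅a, b⁆ = 1 at h2
        rw [map_commutatorElement, commutatorElement_eq_one_iff_mul_comm] at h2
        exact h2.symm
      refine hγ.trans (sup_le ?_ ?_)
      · rw [closure_le]
        intro s hs
        have h1 : (⊤ : Subgroup G) ≤
            (centralizer {QuotientGroup.mk' Q s}).comap (QuotientGroup.mk' Q) := by
          rw [← hS₀, closure_le]
          intro g hg
          refine mem_centralizer_singleton_iff.2 (hcom s g ?_)
          exact le_sup_left (b := γ (i + 2)) (subset_closure ⟨s, hs, g, hg, rfl⟩)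
        refine mem_center_iff.2 fun q => ?_
        obtain ⟨g, rfl⟩ := QuotientGroup.mk'_surjective Q q
        exact mem_centralizer_singleton_iff.1 (h1 (mem_top g))
      · intro z hz
        refine mem_center_iff.2 fun q => ?_
        obtain ⟨g, rfl⟩ := QuotientGroup.mk'_surjective Q q
        refine hcom z g ?_
        have h1 : ⁅z, g⁆ ∈ γ (i + 2) := commutator_mem_commutator hz (mem_top g)
        exact le_sup_right (a := closure _) h1
    refine commutator_le.2 fun x hx g _ => ?_
    have h1 := mem_center_iff.1 (hcen hx) (QuotientGroup.mk' Q g)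
    refine (QuotientGroup.eq_one_iff _).1 ?_
    change QuotientGroup.mk' Q ⁅x, g⁆ = 1
    rw [map_commutatorElement, commutatorElement_eq_one_iff_mul_comm]
    exact h1.symm

theorem fg_of_isNilpotent [Group.FG G] [Group.IsNilpotent G] (H : Subgroup G) : H.FG := by
  obtain ⟨n, hn⟩ := nilpotent_iff_lowerCentralSeries.1 (inferInstance : Group.IsNilpotent G)
  have h1 : ∀ k i, i + k = n → (H ⊓ γ i).FG := by
    intro k
    induction k with
    | zero =>
      rintro i rfl
      rw [add_zero] at hn
      rw [hn, inf_bot_eq]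
      exact FG.bot
    | succ k ih =>
      intro i hi
      obtain ⟨S, hSf, hS, hγ⟩ := exists_finite_closure_sup_lowerCentralSeries (G := G) i
      refine fg_of_inf_fg (commutator_top_lowerCentralSeries_self_le i) hSf hS hγ
        (lowerCentralSeries_antitone _ (Nat.le_succ i)) inf_le_right ?_
      have h2 := ih (i + 1) (by omega)
      rwa [inf_assoc, inf_eq_right.2 (lowerCentralSeries_antitone (⊤ : Subgroup G) (Nat.le_succ i))]
  have h2 := h1 n 0 (zero_add n)
  rwa [lowerCentralSeries_zero, inf_top_eq] at h2

theorem exists_forall_pow_mem {A B : Subgroup G} (h : ⁅A, A⁆ ≤ B) (hA : A.FG) :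
    ∃ E, 0 < E ∧ ∀ x ∈ A, (∃ k, 0 < k ∧ x ^ k ∈ B) → x ^ E ∈ B := by
  obtain ⟨Q, _, f, hfs, hf⟩ := exists_hom_commGroup h
  have : Group.FG A := (Group.fg_iff_subgroup_fg A).2 hA
  have : Group.FG Q := Group.fg_of_surjective hfs
  have : Group.FG (CommGroup.torsion Q) := (Group.fg_iff_subgroup_fg _).2 (fg_of_commGroup _)
  have hfin : Finite (CommGroup.torsion Q) :=
    CommGroup.finite_of_fg_isMulTorsion _ CommMonoid.torsion.isMulTorsion
  refine ⟨Nat.card (CommGroup.torsion Q), Nat.card_pos, ?_⟩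
  rintro x hx ⟨k, hk, hkx⟩
  have h1 : f ⟨x, hx⟩ ^ k = 1 := by
    rw [← map_pow]; exact (hf _).2 hkx
  have h2 : f ⟨x, hx⟩ ∈ CommGroup.torsion Q := isOfFinOrder_iff_pow_eq_one.2 ⟨k, hk, h1⟩
  have h3 : (⟨f ⟨x, hx⟩, h2⟩ : CommGroup.torsion Q) ^ Nat.card (CommGroup.torsion Q) = 1 :=
    pow_card_eq_one'
  have h4 := congrArg Subtype.val h3
  rw [SubmonoidClass.mk_pow] at h4
  refine (hf (⟨x, hx⟩ ^ Nat.card (CommGroup.torsion Q))).1 ?_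
  rw [map_pow]
  exact h4

theorem exists_coordinates {R : Type*} [CommRing R] {A B : Subgroup G} {Q : Type*} [CommGroup Q]
    [Module R (Additive Q)] [Module.Free R (Additive Q)] [Module.Finite R (Additive Q)]
    {f : A →* Q} (hfs : Function.Surjective f) (hf : ∀ a : A, f a = 1 ↔ (a : G) ∈ B)
    [Nontrivial R] :
    ∃ (s : ℕ) (ψ : G → Fin s → R), (∀ x ∈ A, ∀ y ∈ A, ψ (x * y) = ψ x + ψ y) ∧
      (∀ x ∈ A, ψ x = 0 ↔ x ∈ B) ∧ ∀ v, ∃ x ∈ A, ψ x = v := by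
  classical
  let b := Module.finBasis R (Additive Q)
  -- The value outside `A` is a dummy.
  let ψ : G → Fin _ → R := fun x => if hx : x ∈ A then b.equivFun (Additive.ofMul (f ⟨x, hx⟩)) else 0
  have hψ : ∀ x (hx : x ∈ A), ψ x = b.equivFun (Additive.ofMul (f ⟨x, hx⟩)) :=
    fun x hx => dif_pos hx
  refine ⟨_, ψ, fun x hx y hy => ?_, fun x hx => ?_, fun v => ?_⟩
  · rw [hψ _ (A.mul_mem hx hy), hψ x hx, hψ y hy, ← map_add, ← ofMul_mul, ← map_mul]
    rfl
  · rw [hψ x hx, LinearEquiv.map_eq_zero_iff, ofMul_eq_zero, hf]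
  · obtain ⟨a, ha⟩ := hfs (Additive.toMul (b.equivFun.symm v))
    refine ⟨a, a.2, ?_⟩
    rw [hψ _ a.2, Subtype.coe_eta, ha, ofMul_toMul, LinearEquiv.apply_symm_apply]

theorem exists_int_coordinates {A B : Subgroup G} (h : ⁅A, A⁆ ≤ B) (hA : A.FG)
    (hAB : ∀ x ∈ A, ∀ k, 0 < k → x ^ k ∈ B → x ∈ B) :
    ∃ (s : ℕ) (ψ : G → Fin s → ℤ), (∀ x ∈ A, ∀ y ∈ A, ψ (x * y) = ψ x + ψ y) ∧
      (∀ x ∈ A, ψ x = 0 ↔ x ∈ B) ∧ ∀ v, ∃ x ∈ A, ψ x = v := by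
  obtain ⟨Q, _, f, hfs, hf⟩ := exists_hom_commGroup h
  have : Group.FG A := (Group.fg_iff_subgroup_fg A).2 hA
  have : Group.FG Q := Group.fg_of_surjective hfs
  have : Module.Finite ℤ (Additive Q) := Module.Finite.iff_addGroup_fg.2 inferInstance
  have hQ : ∀ (q : Q) (k : ℕ), 0 < k → q ^ k = 1 → q = 1 := by
    intro q k hk hq
    obtain ⟨a, rfl⟩ := hfs q
    rw [← map_pow, hf] at hq
    exact (hf a).2 (hAB a a.2 k hk hq)
  have : IsMulTorsionFree Q := by
    refine ⟨fun n hn x y hxy => ?_⟩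
    have hxy : x ^ n = y ^ n := hxy
    have h1 := hQ (x / y) n (Nat.pos_of_ne_zero hn) (by rw [div_pow, hxy, div_self'])
    exact div_eq_one.1 h1
  have : Module.Free ℤ (Additive Q) := inferInstance
  exact exists_coordinates (R := ℤ) (Q := Q) hfs hf

theorem exists_zmod_coordinates {A B : Subgroup G} (p : ℕ) [Fact p.Prime] (h : ⁅A, A⁆ ≤ B)
    (hA : A.FG) (hAB : ∀ x ∈ A, x ^ p ∈ B) :
    ∃ (s : ℕ) (ψ : G → Fin s → ZMod p), (∀ x ∈ A, ∀ y ∈ A, ψ (x * y) = ψ x + ψ y) ∧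
      (∀ x ∈ A, ψ x = 0 ↔ x ∈ B) ∧ ∀ v, ∃ x ∈ A, ψ x = v := by
  obtain ⟨Q, _, f, hfs, hf⟩ := exists_hom_commGroup h
  have : Group.FG A := (Group.fg_iff_subgroup_fg A).2 hA
  have : Group.FG Q := Group.fg_of_surjective hfs
  have : Module.Finite ℤ (Additive Q) := Module.Finite.iff_addGroup_fg.2 inferInstance
  have hQ : ∀ q : Additive Q, p • q = 0 := by
    intro q
    obtain ⟨a, ha⟩ := hfs (Additive.toMul q)
    have h1 : (Additive.toMul q) ^ p = 1 := by
      rw [← ha, ← map_pow, hf]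
      exact hAB a a.2
    exact h1
  let inst : Module (ZMod p) (Additive Q) := AddCommGroup.zmodModule hQ
  have hfin : Module.Finite (ZMod p) (Additive Q) :=
    Module.Finite.of_restrictScalars_finite ℤ (ZMod p) (Additive Q)
  have hfree : Module.Free (ZMod p) (Additive Q) := Module.Free.of_divisionRing (ZMod p) (Additive Q)
  exact @exists_coordinates G _ (ZMod p) (ZMod.commRing p) A B Q _ inst hfree hfin f hfs hf _

end Subgroup

/-- Exponents multiply along the lower central series: each factor is finitely generated abelian, so
its torsion is finite. -/
theorem exists_forall_pow_eq_one_of_isNilpotent (G : Type u) [Group G] [Group.FG G]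
    [Group.IsNilpotent G] : ∃ E, 0 < E ∧ ∀ x : G, (∃ k, 0 < k ∧ x ^ k = 1) → x ^ E = 1 := by
  obtain ⟨n, hn⟩ :=
    Subgroup.nilpotent_iff_lowerCentralSeries.1 (inferInstance : Group.IsNilpotent G)
  have h1 : ∀ k i, i + k = n → ∃ E, 0 < E ∧
      ∀ x ∈ (⊤ : Subgroup G).lowerCentralSeries i, (∃ k, 0 < k ∧ x ^ k = 1) → x ^ E = 1 := by
    intro k
    induction k with
    | zero =>
      rintro i rfl
      refine ⟨1, one_pos, fun x hx _ => ?_⟩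
      rw [add_zero] at hn
      rw [hn, Subgroup.mem_bot] at hx
      rw [hx, one_pow]
    | succ k ih =>
      intro i hi
      obtain ⟨E, hE, hE1⟩ := ih (i + 1) (by omega)
      obtain ⟨F, hF, hF1⟩ := Subgroup.exists_forall_pow_mem
        (Subgroup.commutator_top_lowerCentralSeries_self_le (G := G) i)
        (Subgroup.fg_of_isNilpotent _)
      refine ⟨F * E, Nat.mul_pos hF hE, ?_⟩
      rintro x hx ⟨l, hl, hlx⟩
      rw [pow_mul]
      refine hE1 _ (hF1 x hx ⟨l, hl, by rw [hlx]; exact one_mem _⟩) ⟨l, hl, ?_⟩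
      rw [← pow_mul, mul_comm, pow_mul, hlx, one_pow]
  obtain ⟨E, hE, hE1⟩ := h1 n 0 (zero_add n)
  exact ⟨E, hE, fun x => hE1 x (Subgroup.mem_top x)⟩

/-! ### N-series and their isolators. -/

namespace IsNSeries

variable {G : Type*} [Group G] {N : ℕ → Subgroup G}

theorem le_of_le (hN : IsNSeries N) {i j : ℕ} (hi : 1 ≤ i) (hij : i ≤ j) : N j ≤ N i := by
  induction j, hij using Nat.le_induction with
  | base => exact le_rfl
  | succ j hj ih => exact (hN.succ_le j (hi.trans hj)).trans ih

theorem normal (hN : IsNSeries N) {i : ℕ} (hi : 1 ≤ i) : (N i).Normal := by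
  rw [← Subgroup.commutator_top_left_le_iff, ← hN.one_eq_top]
  exact (hN.commutator_le 1 i le_rfl hi).trans (hN.le_of_le hi (by omega))

theorem commutator_self_le (hN : IsNSeries N) {i : ℕ} (hi : 1 ≤ i) : ⁅N i, N i⁆ ≤ N (i + 1) :=
  (hN.commutator_le i i hi hi).trans (hN.le_of_le (by omega) (by omega))

theorem lowerCentralSeries_le (hN : IsNSeries N) (i : ℕ) :
    (⊤ : Subgroup G).lowerCentralSeries i ≤ N (i + 1) := by
  induction i with
  | zero => rw [hN.one_eq_top]; exact le_top
  | succ i ih =>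
    rw [Subgroup.lowerCentralSeries_succ]
    refine (Subgroup.commutator_mono ih hN.one_eq_top.ge).trans ?_
    exact hN.commutator_le (i + 1) 1 (by omega) le_rfl

theorem isNilpotent (hN : IsNSeries N) {d : ℕ} (hd : N (d + 1) = ⊥) : Group.IsNilpotent G :=
  Subgroup.nilpotent_iff_lowerCentralSeries.2
    ⟨d, eq_bot_iff.2 (hd ▸ hN.lowerCentralSeries_le d)⟩

theorem eq_bot_of_lt (hN : IsNSeries N) {d i : ℕ} (hd : N (d + 1) = ⊥) (hi : d < i) : N i = ⊥ :=
  eq_bot_iff.2 (hd ▸ hN.le_of_le (by omega) hi)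

/-- Everything is checked in the nilpotent quotients of `G` by terms of `N`: products of torsion
elements are torsion there, and so are commutators of elements with commuting positive powers. -/
theorem exists_isolator (hN : IsNSeries N) [Group.IsNilpotent G] :
    ∃ M : ℕ → Subgroup G, IsNSeries M ∧
      ∀ i, 1 ≤ i → ∀ x, x ∈ M i ↔ ∃ k, 0 < k ∧ x ^ k ∈ N i := by
  have h1 : ∀ i, ∃ U : Subgroup G, 1 ≤ i → ∀ x, x ∈ U ↔ ∃ k, 0 < k ∧ x ^ k ∈ N i := by
    intro i
    by_cases hi : 1 ≤ i
    · have := hN.normal hi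
      refine ⟨{ carrier := {x | ∃ k, 0 < k ∧ x ^ k ∈ N i}
                one_mem' := ⟨1, one_pos, by simp⟩
                mul_mem' := ?_
                inv_mem' := ?_ }, fun _ x => Iff.rfl⟩
      · rintro x y ⟨k, hk, hkx⟩ ⟨l, hl, hly⟩
        obtain ⟨m, hm, h⟩ := exists_mul_pow_eq_one_of_isNilpotent (G := G ⧸ N i)
          (x := QuotientGroup.mk' (N i) x) (y := QuotientGroup.mk' (N i) y) hk hl
          (by rw [← map_pow]; exact (QuotientGroup.eq_one_iff _).2 hkx)
          (by rw [← map_pow]; exact (QuotientGroup.eq_one_iff _).2 hly)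
        rw [← map_mul, ← map_pow] at h
        exact ⟨m, hm, (QuotientGroup.eq_one_iff _).1 h⟩
      · rintro x ⟨k, hk, hkx⟩
        exact ⟨k, hk, by rw [inv_pow]; exact inv_mem hkx⟩
    · exact ⟨⊥, fun h => absurd h hi⟩
  choose M hM using h1
  refine ⟨M, ⟨?_, ?_, ?_⟩, hM⟩
  · rw [eq_top_iff]
    exact fun x _ => (hM 1 le_rfl x).2 ⟨1, one_pos, by simp [hN.one_eq_top]⟩
  · intro i hi x hx
    obtain ⟨k, hk, hkx⟩ := (hM (i + 1) (by omega) x).1 hx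
    exact (hM i hi x).2 ⟨k, hk, hN.succ_le i hi hkx⟩
  · intro i j hi hj
    have := hN.normal (i := i + j) (by omega)
    refine Subgroup.commutator_le.2 fun x hx y hy => (hM _ (by omega) _).2 ?_
    obtain ⟨k, hk, hkx⟩ := (hM i hi x).1 hx
    obtain ⟨l, hl, hly⟩ := (hM j hj y).1 hy
    obtain ⟨m, hm, h⟩ := exists_commutator_pow_eq_one_of_isNilpotent (G := G ⧸ N (i + j))
      (x := QuotientGroup.mk' (N (i + j)) x) (y := QuotientGroup.mk' (N (i + j)) y) hk hl (by
        rw [← map_pow, ← map_pow, ← commutatorElement_eq_one_iff_commute, ← map_commutatorElement]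
        exact (QuotientGroup.eq_one_iff _).2
          (hN.commutator_le i j hi hj (Subgroup.commutator_mem_commutator hkx hly)))
    rw [← map_commutatorElement, ← map_pow] at h
    exact ⟨m, hm, (QuotientGroup.eq_one_iff _).1 h⟩

end IsNSeries

/-! ### The restricted N-series of `p`-power products; the second index `j` serves descending
inductions, since the group vanishes for `j > d`. -/

/-- The subgroup generated by the powers `x ^ p ^ a` with `x ∈ N i`, where `i ≥ j` and
`i + a ≥ n`. -/
def pSeries {G : Type*} [Group G] (N : ℕ → Subgroup G) (p n j : ℕ) : Subgroup G :=
  Subgroup.closure {y | ∃ i a, ∃ x ∈ N i, 1 ≤ i ∧ j ≤ i ∧ n ≤ i + a ∧ x ^ p ^ a = y}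

namespace pSeries

open Subgroup

variable {G : Type*} [Group G] {N : ℕ → Subgroup G} {p : ℕ}

theorem pow_mem {n j i a : ℕ} {x : G} (hx : x ∈ N i) (hi : 1 ≤ i) (hj : j ≤ i) (hn : n ≤ i + a) :
    x ^ p ^ a ∈ pSeries N p n j :=
  subset_closure ⟨i, a, x, hx, hi, hj, hn, rfl⟩

theorem anti {n n' j j' : ℕ} (hn : n ≤ n') (hj : j ≤ j') :
    pSeries N p n' j' ≤ pSeries N p n j := by
  refine (closure_le _).2 ?_
  rintro _ ⟨i, a, x, hx, hi, hji, hni, rfl⟩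
  exact pow_mem hx hi (hj.trans hji) (hn.trans hni)

theorem normal (hN : IsNSeries N) (n j : ℕ) : (pSeries N p n j).Normal := by
  refine ⟨fun z hz g => ?_⟩
  induction hz using closure_induction with
  | mem z hz =>
    obtain ⟨i, a, x, hx, hi, hj, hn, rfl⟩ := hz
    rw [← conj_pow]
    exact pow_mem ((hN.normal hi).conj_mem x hx g) hi hj hn
  | one => simp
  | mul x y _ _ hx hy => rw [← conj_mul]; exact mul_mem hx hy
  | inv x _ hx => rw [← conj_inv]; exact inv_mem hx

theorem eq_bot (hN : IsNSeries N) {d : ℕ} (hd : N (d + 1) = ⊥) {n j : ℕ} (hj : d < j) :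
    pSeries N p n j = ⊥ := by
  refine closure_eq_bot_iff.2 ?_
  rintro _ ⟨i, a, x, hx, -, hji, -, rfl⟩
  rw [hN.eq_bot_of_lt hd (hj.trans_le hji), mem_bot] at hx
  rw [hx, one_pow]
  rfl

theorem pow_mem_succ_of_commutator_le (hN : IsNSeries N) {n j : ℕ} (hn : 1 ≤ n)
    (h : ⁅pSeries N p n j, pSeries N p n j⁆ ≤ pSeries N p (n + n) (j + j)) {x : G}
    (hx : x ∈ pSeries N p n j) : x ^ p ∈ pSeries N p (n + 1) j := by
  have := normal (p := p) hN (n + 1) j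
  induction hx using closure_induction with
  | mem z hz =>
    obtain ⟨i, a, x, hx, hi, hj, hn, rfl⟩ := hz
    rw [← pow_mul, ← pow_succ]
    exact pow_mem hx hi hj (by omega)
  | one => simp
  | mul x y hx hy ihx ihy =>
    have h1 : ⁅x, y⁆ ∈ pSeries N p (n + 1) j :=
      anti (by omega) (by omega) (h (commutator_mem_commutator hx hy))
    have h2 := mul_pow_inv_mul_mem h1 p
    rw [← inv_mem_iff]
    exact (mul_mem_cancel_right (mul_mem ihx ihy)).1 h2
  | inv x _ ih => rw [inv_pow]; exact inv_mem ih

/-- Since `⁅⁅u, v⁆, u⁆` has second index beyond `σ`, the assumption `H` makes it negligible, and `⁅u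
^ p, v⁆` is congruent to `⁅u, v⁆ ^ p`, whose first index has grown by one. -/
theorem commutator_pow_mem_succ (hN : IsNSeries N) {σ : ℕ}
    (H : ∀ n m j k, 1 ≤ j → 1 ≤ k → σ < j + k →
      ⁅pSeries N p n j, pSeries N p m k⁆ ≤ pSeries N p (n + m) (j + k))
    {n j s : ℕ} (hn : 1 ≤ n) (hj : 1 ≤ j) (hs : 1 ≤ s) (hσ : 1 ≤ σ) {u v : G}
    (hu : u ∈ pSeries N p n j) (hc : ⁅u, v⁆ ∈ pSeries N p s σ) :
    ⁅u ^ p, v⁆ ∈ pSeries N p (s + 1) σ := by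
  have := normal (p := p) hN (s + 1) σ
  refine (commutatorElement_pow_left_mem_iff ?_ p).2 ?_
  · exact anti (by omega) (by omega)
      (H s n σ j hσ hj (by omega) (commutator_mem_commutator hc hu))
  · exact pow_mem_succ_of_commutator_le hN hs (H s s σ σ hσ hσ (by omega)) hc

theorem commutator_pow_pow_mem (hN : IsNSeries N) {i l : ℕ} (hi : 1 ≤ i) (hl : 1 ≤ l)
    (H : ∀ n m j k, 1 ≤ j → 1 ≤ k → i + l < j + k →
      ⁅pSeries N p n j, pSeries N p m k⁆ ≤ pSeries N p (n + m) (j + k))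
    {x y : G} (hx : x ∈ N i) (hy : y ∈ N l) (a b : ℕ) :
    ⁅x ^ p ^ a, y ^ p ^ b⁆ ∈ pSeries N p (i + a + (l + b)) (i + l) := by
  induction a with
  | zero =>
    induction b with
    | zero =>
      have h1 : ⁅x, y⁆ ∈ N (i + l) :=
        hN.commutator_le i l hi hl (commutator_mem_commutator hx hy)
      have h2 : ⁅x, y⁆ ^ p ^ 0 ∈ pSeries N p (i + 0 + (l + 0)) (i + l) :=
        pow_mem h1 (by omega) le_rfl (by omega)
      simpa using h2
    | succ b ih =>
      rw [← inv_mem_iff, commutatorElement_inv] at ih ⊢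
      rw [pow_succ, pow_mul]
      have h1 : y ^ p ^ b ∈ pSeries N p (l + b) l := pow_mem hy hl le_rfl le_rfl
      exact commutator_pow_mem_succ hN H (s := i + 0 + (l + b)) (by omega) hl (by omega)
        (by omega) h1 ih
  | succ a ih =>
    rw [pow_succ p a, pow_mul]
    have h1 : x ^ p ^ a ∈ pSeries N p (i + a) i := pow_mem hx hi le_rfl le_rfl
    have h2 := commutator_pow_mem_succ hN H (by omega) hi (by omega) (by omega) h1 ih
    exact anti (by omega) le_rfl h2

/-- Descending induction on a lower bound `σ` for `j + k`. Beyond `d` the generators commute; below,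
it suffices to treat commutators of generators. -/
theorem commutator_le (hN : IsNSeries N) {d : ℕ} (hd : N (d + 1) = ⊥) {n m j k : ℕ} (hj : 1 ≤ j)
    (hk : 1 ≤ k) : ⁅pSeries N p n j, pSeries N p m k⁆ ≤ pSeries N p (n + m) (j + k) := by
  have h1 : ∀ t σ, d < σ + t → ∀ n m j k, 1 ≤ j → 1 ≤ k → σ ≤ j + k →
      ⁅pSeries N p n j, pSeries N p m k⁆ ≤ pSeries N p (n + m) (j + k) := by
    intro t
    induction t with
    | zero =>
      intro σ hσ n m j k hj hk hjk
      have := normal (p := p) hN (n + m) (j + k)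
      refine commutator_closure_le ?_
      rintro _ ⟨i, a, x, hx, hi, hji, -, rfl⟩ _ ⟨l, b, y, hy, hl, hkl, -, rfl⟩
      have h2 := hN.commutator_le i l hi hl (commutator_mem_commutator hx hy)
      rw [hN.eq_bot_of_lt hd (by omega), mem_bot, commutatorElement_eq_one_iff_commute] at h2
      rw [commutatorElement_eq_one_iff_commute.2 (h2.pow_pow _ _)]
      exact one_mem _
    | succ t ih =>
      intro σ hσ n m j k hj hk hjk
      have := normal (p := p) hN (n + m) (j + k)
      refine commutator_closure_le ?_
      rintro _ ⟨i, a, x, hx, hi, hji, hni, rfl⟩ _ ⟨l, b, y, hy, hl, hkl, hml, rfl⟩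
      refine anti (by omega) (by omega) (commutator_pow_pow_mem hN hi hl ?_ hx hy a b)
      exact fun n m j k hj hk hjk => ih (σ + 1) (by omega) n m j k hj hk (by omega)
  exact h1 d 1 (by omega) n m j k hj hk (by omega)

theorem pow_mem_succ (hN : IsNSeries N) {d : ℕ} (hd : N (d + 1) = ⊥) {n j : ℕ} (hn : 1 ≤ n)
    (hj : 1 ≤ j) {x : G} (hx : x ∈ pSeries N p n j) : x ^ p ∈ pSeries N p (n + 1) j :=
  pow_mem_succ_of_commutator_le hN hn (commutator_le hN hd hj hj) hx

theorem le_closure_pow (hN : IsNSeries N) {d : ℕ} (hd : N (d + 1) = ⊥) {n j : ℕ} (hn : d ≤ n) :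
    pSeries N p (n + 1) j ≤ Subgroup.closure ((fun x => x ^ p) '' (pSeries N p n j : Set G)) := by
  refine (closure_le _).2 ?_
  rintro _ ⟨i, a, x, hx, hi, hj, hni, rfl⟩
  rcases lt_or_ge d i with h | h
  · rw [hN.eq_bot_of_lt hd h, mem_bot] at hx
    rw [hx, one_pow]
    exact one_mem _
  -- As `i ≤ d ≤ n` and `i + a ≥ n + 1`, the exponent `a` is positive and one `p`-th root can be
  -- taken.
  · obtain ⟨a, rfl⟩ := Nat.exists_eq_add_of_le' (by omega : 1 ≤ a)
    rw [pow_succ, pow_mul]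
    exact subset_closure ⟨_, pow_mem hx hi hj (by omega), rfl⟩

/-- The factor `w` is a product of `p`-th powers `x ^ p`, absorbed one by one: `y ^ p * x ^ p` is
`(y * x) ^ p` times an error with second index `t + 2`, to which induction applies. The bound `2 ≤
n` gives the error first index `n + t + 2`. -/
theorem exists_pow_mul_eq_pow (hN : IsNSeries N) {d : ℕ} (hd : N (d + 1) = ⊥) {n : ℕ}
    (hn : d ≤ n) (hn2 : 2 ≤ n) (s t : ℕ) (hst : d ≤ t + s) {y w : G} (hy : y ∈ pSeries N p n 1)
    (hw : w ∈ pSeries N p (n + 1 + t) (1 + t)) : ∃ z ∈ pSeries N p n 1, y ^ p * w = z ^ p := by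
  induction s generalizing t y w with
  | zero =>
    rw [eq_bot hN hd (by omega), mem_bot] at hw
    exact ⟨y, hy, by rw [hw, mul_one]⟩
  | succ s ih =>
    have key : ∀ y ∈ pSeries N p n 1, ∀ x ∈ pSeries N p (n + t) (1 + t),
        ∃ z ∈ pSeries N p n 1, y ^ p * x ^ p = z ^ p := by
      intro y hy x hx
      have := normal (p := p) hN (n + 1 + (t + 1)) (1 + (t + 1))
      have h1 : ⁅y, x⁆ ∈ pSeries N p (n + 1 + (t + 1)) (1 + (t + 1)) :=
        anti (by omega) (by omega)
          (commutator_le hN hd le_rfl (by omega) (commutator_mem_commutator hy hx))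
      have hyx : y * x ∈ pSeries N p n 1 := mul_mem hy (anti (by omega) (by omega) hx)
      obtain ⟨z, hz, h⟩ := ih (t + 1) (by omega) hyx (mul_pow_inv_mul_mem h1 p)
      exact ⟨z, hz, by rw [← h, mul_inv_cancel_left]⟩
    have hw' := le_closure_pow hN hd (by omega)
      (show w ∈ pSeries N p (n + t + 1) (1 + t) by rwa [add_right_comm])
    clear hw
    induction hw' using closure_induction_right with
    | one => exact ⟨y, hy, mul_one _⟩
    | mul_right w hw x hx ihw =>
      obtain ⟨z, hz, h⟩ := ihw
      obtain ⟨x, hx, rfl⟩ := hx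
      rw [← mul_assoc, h]
      exact key z hz x hx
    | mul_inv_cancel w hw x hx ihw =>
      obtain ⟨z, hz, h⟩ := ihw
      obtain ⟨x, hx, rfl⟩ := hx
      rw [← mul_assoc, h, ← inv_pow]
      exact key z hz x⁻¹ (inv_mem hx)

theorem exists_eq_pow (hN : IsNSeries N) {d : ℕ} (hd : N (d + 1) = ⊥) {n : ℕ} (hn : d ≤ n)
    (hn2 : 2 ≤ n) (e : ℕ) {w : G} (hw : w ∈ pSeries N p (n + e) 1) :
    ∃ z ∈ pSeries N p n 1, w = z ^ p ^ e := by
  induction e generalizing w with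
  | zero => exact ⟨w, hw, by simp⟩
  | succ e ih =>
    obtain ⟨y, hy, h⟩ := exists_pow_mul_eq_pow hN hd (n := n + e) (by omega) (by omega) d 0
      (by omega) (one_mem _) (w := w) hw
    obtain ⟨z, hz, rfl⟩ := ih hy
    exact ⟨z, hz, by rw [one_pow, one_mul] at h; rw [h, ← pow_mul, pow_succ]⟩

theorem clog_add_le (hp : 1 < p) {i j : ℕ} (hi : 1 ≤ i) (hj : 1 ≤ j) :
    Nat.clog p (i + j) ≤ Nat.clog p i + Nat.clog p j + 1 := by
  rw [Nat.clog_le_iff_le_pow hp]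
  have hi' := Nat.le_pow_clog hp i
  have hj' := Nat.le_pow_clog hp j
  rw [pow_succ, pow_add]
  generalize p ^ Nat.clog p i = u at *
  generalize p ^ Nat.clog p j = v at *
  have h1 : u ≤ u * v := Nat.le_mul_of_pos_right u (by omega)
  have h2 : v ≤ u * v := Nat.le_mul_of_pos_left v (by omega)
  nlinarith

/-- The logarithm converts the growth of the first index by one under `p`-th powers into
multiplication of the weight by `p`. The summand `1` in each index pays for the `1` in
`clog_add_le`. -/
theorem isNSeries_clog (hN : IsNSeries N) {d : ℕ} (hd : N (d + 1) = ⊥) (hp : 1 < p) :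
    IsNSeries fun i => pSeries N p (1 + Nat.clog p i) 1 := by
  refine ⟨?_, fun i _ => ?_, fun i j hi hj => ?_⟩
  · rw [eq_top_iff]
    intro x _
    have hx : x ∈ N 1 := by rw [hN.one_eq_top]; exact mem_top x
    have h1 : x ^ p ^ 0 ∈ pSeries N p (1 + Nat.clog p 1) 1 := pow_mem hx le_rfl le_rfl (by simp)
    simpa using h1
  · exact anti (Nat.add_le_add_left (Nat.clog_mono_right p (Nat.le_succ i)) 1) le_rfl
  · refine (commutator_le hN hd le_rfl le_rfl).trans (anti ?_ (by omega))
    have := clog_add_le hp hi hj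
    omega

theorem le_clog (hp : 1 < p) {i : ℕ} (hi : 1 ≤ i) : N i ≤ pSeries N p (1 + Nat.clog p i) 1 := by
  intro x hx
  have h1 : Nat.clog p i ≤ i - 1 := by
    rw [Nat.clog_le_iff_le_pow hp]
    have := Nat.lt_pow_self (n := i - 1) hp
    omega
  have h2 : x ^ p ^ 0 ∈ pSeries N p (1 + Nat.clog p i) 1 := pow_mem hx hi hi (by omega)
  simpa using h2

theorem pow_mem_clog (hN : IsNSeries N) {d : ℕ} (hd : N (d + 1) = ⊥) (hp : 1 < p) {i : ℕ}
    {x : G} (hx : x ∈ pSeries N p (1 + Nat.clog p i) 1) :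
    x ^ p ∈ pSeries N p (1 + Nat.clog p (p * i)) 1 := by
  refine anti ?_ le_rfl (pow_mem_succ hN hd (by omega) le_rfl hx)
  have : Nat.clog p (p * i) ≤ Nat.clog p i + 1 := by
    rw [Nat.clog_le_iff_le_pow hp, pow_succ']
    exact Nat.mul_le_mul_left p (Nat.le_pow_clog hp i)
  omega

end pSeries

/-! ### Filtrations of group rings of subgroups, and expansions in powers of `x - 1`. -/

/-- The part of the filtration induced by `M` that comes from the elements of `H`: the submodule
spanned by the products `(h₁ - 1) ⋯ (hᵣ - 1)`, where `hₛ ∈ H ∩ M kₛ`, `r ≥ 0` and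
`k₁ + ⋯ + kᵣ ≥ i`. -/
noncomputable def filt (R : Type*) [CommRing R] {G : Type*} [Group G] (M : ℕ → Subgroup G)
    (H : Subgroup G) (i : ℕ) : Submodule R (MonoidAlgebra R G) :=
  Submodule.span R
    {x | ∃ l : List (ℕ × G), (∀ q ∈ l, 1 ≤ q.1 ∧ q.2 ∈ H ∧ q.2 ∈ M q.1) ∧
      i ≤ (l.map fun q => q.1).sum ∧ (l.map fun q => MonoidAlgebra.of R G q.2 - 1).prod = x}

namespace filt

open MonoidAlgebra (of)

variable {R : Type*} [CommRing R] {G : Type*} [Group G] {M : ℕ → Subgroup G} {H K : Subgroup G}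

theorem anti {i j : ℕ} (h : i ≤ j) : filt R M H j ≤ filt R M H i :=
  Submodule.span_mono fun _ ⟨l, hl, hi, hx⟩ => ⟨l, hl, h.trans hi, hx⟩

theorem one_mem : (1 : MonoidAlgebra R G) ∈ filt R M H 0 :=
  Submodule.subset_span ⟨[], by simp, by simp, by simp⟩

theorem of_sub_one_mem {h : G} {k : ℕ} (hk : 1 ≤ k) (hH : h ∈ H) (hM : h ∈ M k) :
    of R G h - 1 ∈ filt R M H k :=
  Submodule.subset_span ⟨[(k, h)], by simp [hk, hH, hM], by simp, by simp⟩

theorem of_mem (hM : IsNSeries M) {h : G} (hH : h ∈ H) : of R G h ∈ filt R M H 0 := by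
  have h1 : of R G h - 1 ∈ filt R M H 1 :=
    of_sub_one_mem le_rfl hH (by rw [hM.one_eq_top]; exact Subgroup.mem_top h)
  have h2 := Submodule.add_mem _ (anti (Nat.zero_le 1) h1) one_mem
  rwa [sub_add_cancel] at h2

theorem mul_mem {i j : ℕ} {x y : MonoidAlgebra R G} (hx : x ∈ filt R M H i)
    (hy : y ∈ filt R M H j) : x * y ∈ filt R M H (i + j) := by
  have h1 : filt R M H i * filt R M H j ≤ filt R M H (i + j) := by
    unfold filt
    rw [Submodule.span_mul_span, Submodule.span_le]
    rintro _ ⟨_, ⟨l, hl, hi, rfl⟩, _, ⟨l', hl', hj, rfl⟩, rfl⟩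
    refine Submodule.subset_span ⟨l ++ l', fun q hq => ?_, ?_, by simp⟩
    · rcases List.mem_append.1 hq with hq | hq
      · exact hl q hq
      · exact hl' q hq
    · simp only [List.map_append, List.sum_append]
      omega
  exact h1 (Submodule.mul_mem_mul hx hy)

theorem le_of_forall_mul_mem {V : ℕ → Submodule R (MonoidAlgebra R G)} (hV : Antitone V)
    (h1 : (1 : MonoidAlgebra R G) ∈ V 0)
    (hmul : ∀ k, 1 ≤ k → ∀ h ∈ H, h ∈ M k → ∀ i, ∀ z ∈ V i, (of R G h - 1) * z ∈ V (i + k))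
    (i : ℕ) : filt R M H i ≤ V i := by
  refine Submodule.span_le.2 ?_
  rintro _ ⟨l, hl, hi, rfl⟩
  refine hV hi ?_
  clear hi
  induction l with
  | nil => simpa using h1
  | cons q l ih =>
    obtain ⟨hq1, hq2, hq3⟩ := hl q List.mem_cons_self
    have h2 := hmul q.1 hq1 q.2 hq2 hq3 _ _ (ih fun q' hq' => hl q' (List.mem_cons_of_mem _ hq'))
    simpa [add_comm] using h2

theorem le_span_of (i : ℕ) : filt R M K i ≤ Submodule.span R (of R G '' (K : Set G)) := by
  refine le_of_forall_mul_mem (V := fun _ => Submodule.span R (of R G '' (K : Set G)))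
    antitone_const ?_ ?_ i
  · exact Submodule.subset_span ⟨1, K.one_mem, map_one _⟩
  · intro k _ h hh _ _ z hz
    rw [sub_mul, one_mul]
    refine Submodule.sub_mem _ ?_ hz
    have h1 : Submodule.span R (of R G '' (K : Set G)) ≤
        (Submodule.span R (of R G '' (K : Set G))).comap (LinearMap.mulLeft R (of R G h)) := by
      refine Submodule.span_le.2 ?_
      rintro _ ⟨k, hk, rfl⟩
      exact Submodule.subset_span ⟨h * k, K.mul_mem hh hk, map_mul _ _ _⟩
    exact h1 hz

theorem lift_one_eq_zero {i : ℕ} (hi : 1 ≤ i) {z : MonoidAlgebra R G} (hz : z ∈ filt R M H i) :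
    MonoidAlgebra.lift R R G 1 z = 0 := by
  have h1 := le_of_forall_mul_mem (M := M) (H := H)
    (V := fun i => if i = 0 then ⊤ else LinearMap.ker (MonoidAlgebra.lift R R G 1).toLinearMap)
    ?_ ?_ ?_ i hz
  · rw [if_neg (by omega)] at h1
    exact h1
  · intro i j hij
    dsimp only
    split_ifs with h1 h2
    · exact le_rfl
    · omega
    · exact le_top
    · exact le_rfl
  · simp
  · intro k hk h _ _ i z _
    rw [if_neg (by omega)]
    simp [sub_mul]

section Conj

variable {w : ℕ}

/-- Conjugation is multiplicative, and moves a factor `h - 1` of weight `k` by `h * (c - 1)`, where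
`c` is a commutator in `M (k + w)`. -/
theorem conj_mem_and_sub_mem (hM : IsNSeries M) (hw : 1 ≤ w) {y : G} (hyM : y ∈ M w)
    (hyK : ∀ k ∈ K, y⁻¹ * k * y ∈ K) {s : ℕ} {u : MonoidAlgebra R G} (hu : u ∈ filt R M K s) :
    of R G y⁻¹ * u * of R G y ∈ filt R M K s ∧
      of R G y⁻¹ * u * of R G y - u ∈ filt R M K (s + w) := by
  obtain ⟨σ, hσ⟩ : ∃ σ : MonoidAlgebra R G →ₗ[R] MonoidAlgebra R G,
      ∀ u, σ u = of R G y⁻¹ * u * of R G y :=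
    ⟨LinearMap.mulRight R (of R G y) ∘ₗ LinearMap.mulLeft R (of R G y⁻¹), fun _ => rfl⟩
  have hyy : of R G y * of R G y⁻¹ = 1 := by rw [← map_mul, mul_inv_cancel, map_one]
  have hyy' : of R G y⁻¹ * of R G y = 1 := by rw [← map_mul, inv_mul_cancel, map_one]
  have hσmul : ∀ u v, σ (u * v) = σ u * σ v := by
    intro u v
    have h1 : ∀ a b c d : MonoidAlgebra R G, a * (c * d) * b = a * c * 1 * d * b := by
      intro a b c d; rw [mul_one]; noncomm_ring
    rw [hσ, hσ, hσ, h1, ← hyy]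
    noncomm_ring
  have hσ1 : σ 1 = 1 := by rw [hσ, mul_one, hyy']
  have hσof : ∀ g, σ (of R G g) = of R G (y⁻¹ * g * y) := by
    intro g; rw [hσ, map_mul, map_mul]
  have key := le_of_forall_mul_mem (R := R) (M := M) (H := K)
    (V := fun s => (filt R M K s).comap σ ⊓ (filt R M K (s + w)).comap (σ - LinearMap.id))
    ?_ ?_ ?_ s hu
  · rw [← hσ]
    exact key
  · intro i j hij z hz
    exact ⟨anti hij hz.1, anti (by omega) hz.2⟩
  · rw [Submodule.mem_inf, Submodule.mem_comap, Submodule.mem_comap, LinearMap.sub_apply,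
      LinearMap.id_apply, hσ1, sub_self]
    exact ⟨one_mem, Submodule.zero_mem _⟩
  · intro k hk h hh hhM i z hz
    rw [Submodule.mem_inf, Submodule.mem_comap, Submodule.mem_comap, LinearMap.sub_apply,
      LinearMap.id_apply] at hz ⊢
    obtain ⟨hz1, hz2⟩ := hz
    have hn := hM.normal hk
    have h1 : y⁻¹ * h * y ∈ M k := by
      simpa using hn.conj_mem h hhM y⁻¹
    have h2 : σ (of R G h - 1) = of R G (y⁻¹ * h * y) - 1 := by
      rw [map_sub, hσ1, hσof]
    have h3 : σ (of R G h - 1) - (of R G h - 1) ∈ filt R M K (k + w) := by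
      have hc : h⁻¹ * (y⁻¹ * h * y) ∈ M (k + w) := by
        have := hM.commutator_le k w hk hw
          (Subgroup.commutator_mem_commutator (inv_mem hhM) (inv_mem hyM))
        simpa [commutatorElement_def, mul_assoc] using this
      have hcK : h⁻¹ * (y⁻¹ * h * y) ∈ K := K.mul_mem (K.inv_mem hh) (hyK h hh)
      have h4 := mul_mem (of_mem (R := R) hM hh) (of_sub_one_mem (R := R) (by omega) hcK hc)
      rw [zero_add, mul_sub, ← map_mul, mul_inv_cancel_left, mul_one] at h4
      rwa [h2, sub_sub_sub_cancel_right]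
    refine ⟨?_, ?_⟩
    · rw [hσmul, h2, add_comm]
      exact mul_mem (of_sub_one_mem hk (hyK h hh) h1) hz1
    · have h5 : σ ((of R G h - 1) * z) - (of R G h - 1) * z =
          (σ (of R G h - 1) - (of R G h - 1)) * σ z + (of R G h - 1) * (σ z - z) := by
        rw [hσmul]; noncomm_ring
      rw [h5]
      refine Submodule.add_mem _ ?_ ?_
      · exact anti (by omega) (mul_mem h3 hz1)
      · exact anti (by omega) (mul_mem (of_sub_one_mem hk hh hhM) hz2)

end Conj

/-- The submodule spanned by the elements `x ^ a * (x - 1) ^ j * δ`, where `δ` has weight at least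
`i - j * w` in the filtration of `R[K]`. -/
noncomputable def cyclicFilt (R : Type*) [CommRing R] {G : Type*} [Group G] (M : ℕ → Subgroup G)
    (K : Subgroup G) (x : G) (w i : ℕ) : Submodule R (MonoidAlgebra R G) :=
  Submodule.span R {z | ∃ (a : ℤ) (j : ℕ), ∃ δ ∈ filt R M K (i - j * w),
    of R G (x ^ a) * ((of R G x - 1) ^ j * δ) = z}

namespace cyclicFilt

variable {x : G} {w : ℕ}

theorem anti : Antitone (cyclicFilt R M K x w) := by
  intro i i' h
  refine Submodule.span_mono ?_
  rintro _ ⟨a, j, δ, hδ, rfl⟩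
  exact ⟨a, j, δ, filt.anti (by omega) hδ, rfl⟩

theorem mem {i j : ℕ} (a : ℤ) {δ : MonoidAlgebra R G} (hδ : δ ∈ filt R M K (i - j * w)) :
    of R G (x ^ a) * ((of R G x - 1) ^ j * δ) ∈ cyclicFilt R M K x w i :=
  Submodule.subset_span ⟨a, j, δ, hδ, rfl⟩

theorem mem' {i j : ℕ} {δ : MonoidAlgebra R G} (hδ : δ ∈ filt R M K (i - j * w)) :
    (of R G x - 1) ^ j * δ ∈ cyclicFilt R M K x w i := by
  have h1 := mem (x := x) 0 hδ
  rwa [zpow_zero, map_one, one_mul] at h1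

theorem mul_mem_of_forall {u : MonoidAlgebra R G} {i i' : ℕ}
    (h : ∀ (a : ℤ) (j : ℕ), ∀ δ ∈ filt R M K (i - j * w),
      u * (of R G (x ^ a) * ((of R G x - 1) ^ j * δ)) ∈ cyclicFilt R M K x w i')
    {z : MonoidAlgebra R G} (hz : z ∈ cyclicFilt R M K x w i) :
    u * z ∈ cyclicFilt R M K x w i' := by
  have h1 : cyclicFilt R M K x w i ≤ (cyclicFilt R M K x w i').comap (LinearMap.mulLeft R u) := by
    refine Submodule.span_le.2 ?_
    rintro _ ⟨a, j, δ, hδ, rfl⟩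
    exact h a j δ hδ
  exact h1 hz

theorem of_zpow_mul_mem (b : ℤ) {i : ℕ} {z : MonoidAlgebra R G}
    (hz : z ∈ cyclicFilt R M K x w i) : of R G (x ^ b) * z ∈ cyclicFilt R M K x w i := by
  refine mul_mem_of_forall (fun a j δ hδ => ?_) hz
  rw [← mul_assoc, ← map_mul, ← zpow_add]
  exact mem _ hδ

theorem of_sub_one_mul_mem {i : ℕ} {z : MonoidAlgebra R G}
    (hz : z ∈ cyclicFilt R M K x w i) : (of R G x - 1) * z ∈ cyclicFilt R M K x w (i + w) := by
  refine mul_mem_of_forall (fun a j δ hδ => ?_) hz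
  have h1 : (of R G x - 1) * of R G (x ^ a) = of R G (x ^ a) * (of R G x - 1) := by
    rw [sub_mul, mul_sub, ← map_mul, ← map_mul, one_mul, mul_one, ← zpow_one_add, ← zpow_add_one,
      add_comm]
  rw [← mul_assoc, h1, mul_assoc, ← mul_assoc (of R G x - 1), ← pow_succ']
  exact mem a (filt.anti (by rw [Nat.succ_mul]; omega) hδ)

theorem of_zpow_sub_one_mul_mem (a : ℤ) {i : ℕ} {z : MonoidAlgebra R G}
    (hz : z ∈ cyclicFilt R M K x w i) :
    (of R G (x ^ a) - 1) * z ∈ cyclicFilt R M K x w (i + w) := by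
  induction a with
  | zero => rw [zpow_zero, map_one, sub_self, zero_mul]; exact Submodule.zero_mem _
  | succ n ih =>
    have h1 : (of R G (x ^ ((n : ℤ) + 1)) - 1) * z =
        of R G (x ^ (1 : ℤ)) * ((of R G (x ^ (n : ℤ)) - 1) * z) + (of R G x - 1) * z := by
      rw [add_comm (n : ℤ), zpow_add, map_mul, zpow_one]; noncomm_ring
    rw [h1]
    exact Submodule.add_mem _ (of_zpow_mul_mem 1 ih) (of_sub_one_mul_mem hz)
  | pred n ih =>
    have h1 : (of R G (x ^ (-(n : ℤ) - 1)) - 1) * z =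
        of R G (x ^ (-1 : ℤ)) * ((of R G (x ^ (-(n : ℤ))) - 1) * z - (of R G x - 1) * z) := by
      have h2 : of R G (x ^ (-1 : ℤ)) * of R G x = 1 := by
        rw [← map_mul, zpow_neg_one, inv_mul_cancel, map_one]
      have h3 : of R G (x ^ (-(n : ℤ) - 1)) = of R G (x ^ (-1 : ℤ)) * of R G (x ^ (-(n : ℤ))) := by
        rw [← map_mul, ← zpow_add]; congr 2; ring
      rw [h3]
      have h4 : ∀ a b c : MonoidAlgebra R G,
          a * ((b - 1) * z - (c - 1) * z) = (a * b - a * c) * z := by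
        intro a b c; noncomm_ring
      rw [h4, h2]
    rw [h1]
    exact of_zpow_mul_mem _ (Submodule.sub_mem _ ih (of_sub_one_mul_mem hz))

/-- Let `u'` be the conjugate `x⁻¹ * u * x`. From `u * (x - 1) = (x - 1) * u' + (u' - u)`, a
coefficient moves to the right past `x - 1`; where the factor `x - 1` is lost, `u' - u` has gained
its weight `w`. -/
theorem mul_mem (hM : IsNSeries M) (hw : 1 ≤ w) (hxM : x ∈ M w)
    (hxK : ∀ (a : ℤ), ∀ k ∈ K, (x ^ a)⁻¹ * k * x ^ a ∈ K) {s i : ℕ} {u z : MonoidAlgebra R G}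
    (hu : u ∈ filt R M K s) (hz : z ∈ cyclicFilt R M K x w i) :
    u * z ∈ cyclicFilt R M K x w (i + s) := by
  have hx1 : of R G x * of R G x⁻¹ = 1 := by rw [← map_mul, mul_inv_cancel, map_one]
  have key : ∀ (j s : ℕ) (u : MonoidAlgebra R G), u ∈ filt R M K s → ∀ i,
      ∀ δ ∈ filt R M K (i - j * w), u * ((of R G x - 1) ^ j * δ) ∈ cyclicFilt R M K x w (i + s) := by
    intro j
    induction j with
    | zero =>
      intro s u hu i δ hδ
      rw [pow_zero, one_mul]
      have h1 : u * δ ∈ filt R M K (i + s - 0 * w) := by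
        refine filt.anti ?_ (filt.mul_mem hu hδ)
        omega
      have h2 := mem' (x := x) h1
      rwa [pow_zero, one_mul] at h2
    | succ j ih =>
      intro s u hu i δ hδ
      have h1 := conj_mem_and_sub_mem hM hw hxM (by simpa using hxK 1) hu
      have hδ' : δ ∈ filt R M K (i - w - j * w) := by
        refine filt.anti ?_ hδ
        rw [Nat.succ_mul]; omega
      have h2 : u * ((of R G x - 1) ^ (j + 1) * δ) =
          (of R G x - 1) * ((of R G x⁻¹ * u * of R G x) * ((of R G x - 1) ^ j * δ)) +
            (of R G x⁻¹ * u * of R G x - u) * ((of R G x - 1) ^ j * δ) := by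
        have h3 : of R G x * (of R G x⁻¹ * u * of R G x) = u * of R G x := by
          rw [mul_assoc (of R G x⁻¹), ← mul_assoc, hx1, one_mul]
        have h4 : u * (of R G x - 1) = (of R G x - 1) * (of R G x⁻¹ * u * of R G x) +
            (of R G x⁻¹ * u * of R G x - u) := by
          rw [sub_mul, h3, mul_sub, one_mul, mul_one]; abel
        rw [pow_succ', mul_assoc, ← mul_assoc u, h4]
        noncomm_ring
      rw [h2]
      refine Submodule.add_mem _ (anti ?_ (of_sub_one_mul_mem (ih s _ h1.1 (i - w) δ hδ')))
        (anti ?_ (ih (s + w) _ h1.2 (i - w) δ hδ')) <;> omega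
  refine mul_mem_of_forall (fun a j δ hδ => ?_) hz
  have h1 := (conj_mem_and_sub_mem hM hw (Subgroup.zpow_mem _ hxM a) (hxK a) hu).1
  have h2 : u * of R G (x ^ a) = of R G (x ^ a) * (of R G (x ^ a)⁻¹ * u * of R G (x ^ a)) := by
    rw [mul_assoc (of R G (x ^ a)⁻¹), ← mul_assoc (of R G (x ^ a)), ← map_mul, mul_inv_cancel,
      map_one, one_mul]
  rw [← mul_assoc, h2, mul_assoc]
  exact of_zpow_mul_mem a (key j s _ h1 i δ hδ)

theorem filt_le (hM : IsNSeries M) (hw : 1 ≤ w) (hx : x ∈ H) (hKH : K ≤ H) (hHM : H ≤ M w)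
    (hMK : H ⊓ M (w + 1) ≤ K) (hHK : ∀ h ∈ H, ∀ k ∈ K, h⁻¹ * k * h ∈ K)
    (hdec : ∀ h ∈ H, ∃ a : ℤ, x ^ (-a) * h ∈ K) (i : ℕ) :
    filt R M H i ≤ cyclicFilt R M K x w i := by
  have hxK : ∀ (a : ℤ), ∀ k ∈ K, (x ^ a)⁻¹ * k * x ^ a ∈ K :=
    fun a => hHK _ (H.zpow_mem hx a)
  refine le_of_forall_mul_mem anti ?_ ?_ i
  · have h1 : (1 : MonoidAlgebra R G) ∈ filt R M K (0 - 0 * w) := filt.anti (by omega) one_mem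
    have h2 := mem' (x := x) h1
    rwa [pow_zero, one_mul] at h2
  · intro v hv h hh hhM i z hz
    -- If `v > w`, then `h` lies in `K`. Otherwise `h = x ^ a * k` with `k ∈ K`, and `h - 1 = x ^ a
    -- * (k - 1) + (x ^ a - 1)` has weight at least `w ≥ v`.
    rcases Nat.lt_or_ge w v with hwv | hwv
    · have hhK : h ∈ K := hMK ⟨hh, hM.le_of_le (by omega) hwv hhM⟩
      exact mul_mem hM hw (hHM hx) hxK (of_sub_one_mem hv hhK hhM) hz
    · obtain ⟨a, ha⟩ := hdec h hh
      refine anti (Nat.add_le_add_left hwv i) ?_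
      have h1 : (of R G h - 1) * z = of R G (x ^ a) * ((of R G (x ^ (-a) * h) - 1) * z) +
          (of R G (x ^ a) - 1) * z := by
        have h2 : of R G h = of R G (x ^ a) * of R G (x ^ (-a) * h) := by
          rw [← map_mul, ← mul_assoc, ← zpow_add, add_neg_cancel, zpow_zero, one_mul]
        rw [h2]; noncomm_ring
      rw [h1]
      refine Submodule.add_mem _ (of_zpow_mul_mem a ?_) (of_zpow_sub_one_mul_mem a hz)
      exact mul_mem hM hw (hHM hx) hxK (of_sub_one_mem hw ha (hHM (hKH ha))) hz

end cyclicFilt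

end filt

/-! ### Coefficient maps, and dimension subgroups over `ℤ` and `ZMod p`. -/

namespace filt

open MonoidAlgebra (of)

section CoefficientMaps

variable {R : Type*} [CommRing R] {G : Type*} [Group G] {M : ℕ → Subgroup G} {H K : Subgroup G}

theorem exists_linearMap_of (F : G → MonoidAlgebra R G) :
    ∃ c : MonoidAlgebra R G →ₗ[R] MonoidAlgebra R G, ∀ g, c (of R G g) = F g :=
  ⟨(MonoidAlgebra.basis G R).constr R F, fun g => by
    rw [← Module.Basis.constr_basis (MonoidAlgebra.basis G R) R F g, MonoidAlgebra.basis_apply]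
    rfl⟩

theorem of_mul_mem_span {P P' : Set G} {g : G} (h : ∀ h ∈ P, g * h ∈ P') {z : MonoidAlgebra R G}
    (hz : z ∈ Submodule.span R (of R G '' P)) : of R G g * z ∈ Submodule.span R (of R G '' P') := by
  have h1 : Submodule.span R (of R G '' P) ≤
      (Submodule.span R (of R G '' P')).comap (LinearMap.mulLeft R (of R G g)) := by
    refine Submodule.span_le.2 ?_
    rintro _ ⟨k, hk, rfl⟩
    exact Submodule.subset_span ⟨g * k, h k hk, map_mul _ _ _⟩
  exact h1 hz

variable {x : G} {t : G → R} {τ : G → ℤ} {c₀ c₁ : MonoidAlgebra R G →ₗ[R] MonoidAlgebra R G}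

/-- The maps `c₀` and `c₁` play the roles of the value and the derivative at `x = 1`. The set `P`
confines the support to where `τ` and `t` are additive; over `ZMod p` this excludes a carry in the
lift `τ`. -/
theorem coeff_zpow_mul (hc₀ : ∀ g, c₀ (of R G g) = of R G (x ^ (-τ g) * g))
    (hc₁ : ∀ g, c₁ (of R G g) = t g • of R G (x ^ (-τ g) * g)) {P : Set G} {a : ℤ}
    (hτ : ∀ h ∈ P, τ (x ^ a * h) = τ h + a) (ht : ∀ h ∈ P, t (x ^ a * h) = t h + a)
    {z : MonoidAlgebra R G} (hz : z ∈ Submodule.span R (of R G '' P)) :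
    c₀ (of R G (x ^ a) * z) = c₀ z ∧ c₁ (of R G (x ^ a) * z) = c₁ z + (a : R) • c₀ z := by
  have key : ∀ h ∈ P, x ^ (-τ (x ^ a * h)) * (x ^ a * h) = x ^ (-τ h) * h := by
    intro h hh
    rw [hτ h hh, ← mul_assoc, ← zpow_add]
    congr 2
    ring
  induction hz using Submodule.span_induction with
  | mem z hz =>
    obtain ⟨h, hh, rfl⟩ := hz
    rw [← map_mul, hc₀, hc₁, hc₀, hc₁, key h hh, ht h hh, add_smul]
    exact ⟨rfl, rfl⟩
  | zero => simp
  | add y z _ _ hy hz =>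
    rw [mul_add, map_add, map_add, map_add, map_add, hy.1, hz.1, hy.2, hz.2, smul_add]
    exact ⟨rfl, by abel⟩
  | smul r z _ hz =>
    rw [mul_smul_comm, map_smul, map_smul, map_smul, map_smul, hz.1, hz.2, smul_add, smul_comm r]
    exact ⟨rfl, rfl⟩

theorem coeff_pow_sub_one_mul (hc₀ : ∀ g, c₀ (of R G g) = of R G (x ^ (-τ g) * g))
    (hc₁ : ∀ g, c₁ (of R G g) = t g • of R G (x ^ (-τ g) * g)) {P : ℕ → Set G} {B : ℕ}
    (hP0 : (K : Set G) ⊆ P 0) (hPs : ∀ j, P j ⊆ P (j + 1))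
    (hPx : ∀ j, j + 1 < B → ∀ h ∈ P j,
      x * h ∈ P (j + 1) ∧ τ (x * h) = τ h + 1 ∧ t (x * h) = t h + 1)
    (hτK : ∀ k ∈ K, τ k = 0) (htK : ∀ k ∈ K, t k = 0) {s : ℕ} {δ : MonoidAlgebra R G}
    (hδ : δ ∈ filt R M K s) {j : ℕ} (hj : j < B) :
    (of R G x - 1) ^ j * δ ∈ Submodule.span R (of R G '' P j) ∧
      c₀ ((of R G x - 1) ^ j * δ) = (if j = 0 then δ else 0) ∧
      c₁ ((of R G x - 1) ^ j * δ) = (if j = 1 then δ else 0) := by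
  induction j with
  | zero =>
    have hδK := le_span_of s hδ
    rw [pow_zero, one_mul, if_pos rfl, if_neg zero_ne_one]
    refine ⟨Submodule.span_mono (Set.image_mono hP0) hδK, ?_, ?_⟩
    · have h1 : Set.EqOn c₀ (LinearMap.id (R := R) (M := MonoidAlgebra R G))
          (of R G '' (K : Set G)) := by
        rintro _ ⟨k, hk, rfl⟩
        rw [hc₀, hτK k hk, neg_zero, zpow_zero, one_mul, LinearMap.id_apply]
      exact LinearMap.eqOn_span h1 hδK
    · have h1 : Set.EqOn c₁ (0 : MonoidAlgebra R G →ₗ[R] MonoidAlgebra R G)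
          (of R G '' (K : Set G)) := by
        rintro _ ⟨k, hk, rfl⟩
        rw [hc₁, htK k hk, zero_smul, LinearMap.zero_apply]
      exact LinearMap.eqOn_span h1 hδK
  | succ j ih =>
    obtain ⟨h1, h2, h3⟩ := ih (by omega)
    obtain ⟨h4, h5⟩ := coeff_zpow_mul (a := 1) hc₀ hc₁
      (fun h hh => by rw [zpow_one]; exact (hPx j hj h hh).2.1)
      (fun h hh => by rw [zpow_one, Int.cast_one]; exact (hPx j hj h hh).2.2) h1
    rw [zpow_one] at h4 h5
    rw [pow_succ', mul_assoc, sub_mul, one_mul, map_sub, map_sub, h4, h5, sub_self,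
      add_sub_cancel_left, Int.cast_one, one_smul, h2]
    refine ⟨Submodule.sub_mem _ (of_mul_mem_span (fun h hh => (hPx j hj h hh).1) h1)
      (Submodule.span_mono (Set.image_mono (hPs j)) h1), ?_, ?_⟩
    · rw [if_neg (by omega)]
    · simp

/-- The elements `h` of `H` for which `h - 1` has weight at least `i` in the filtration of `R[H]`
belong to `M i`, for `1 ≤ i ≤ n`. -/
def DimensionLE (R : Type*) [CommRing R] {G : Type*} [Group G] (M : ℕ → Subgroup G) (n : ℕ)
    (H : Subgroup G) : Prop :=
  ∀ i, 1 ≤ i → i ≤ n → ∀ h ∈ H, of R G h - 1 ∈ filt R M H i → h ∈ M i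

/-- For `i > w`, `c₁ (h - 1)` is `t h` times a group element and has positive weight, so its
augmentation `t h` vanishes and `h ∈ K`. Then `c₀` fixes `h - 1` and puts it into the filtration of
`R[K]`. -/
theorem DimensionLE.of_coeff (hM : IsNSeries M) {n w : ℕ} (hHM : H ≤ M w)
    (hc₀ : ∀ k ∈ K, c₀ (of R G k) = of R G k)
    (hc₁ : ∀ g, c₁ (of R G g) = t g • of R G (x ^ (-τ g) * g)) (ht1 : t 1 = 0)
    (htK : ∀ h ∈ H, t h = 0 → h ∈ K)
    (hc : ∀ i, ∀ z ∈ filt R M H i, c₀ z ∈ filt R M K i ∧ c₁ z ∈ filt R M K (i - w))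
    (hK : DimensionLE R M n K) : DimensionLE R M n H := by
  intro i hi hin h hh hz
  rcases Nat.lt_or_ge w i with hwi | hwi
  · obtain ⟨h1, h2⟩ := hc i _ hz
    have h3 : h ∈ K := by
      refine htK h hh ?_
      rw [map_sub, hc₁, ← map_one (of R G), hc₁, ht1, zero_smul, sub_zero] at h2
      have h4 := lift_one_eq_zero (by omega) h2
      rwa [map_smul, MonoidAlgebra.lift_of, MonoidHom.one_apply, smul_eq_mul, mul_one] at h4
    have h5 : c₀ (1 : MonoidAlgebra R G) = 1 := by
      have := hc₀ 1 K.one_mem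
      rwa [map_one] at this
    rw [map_sub, hc₀ h h3, h5] at h1
    exact hK i hi hin h h3 h1
  · exact hM.le_of_le hi hwi (hHM hh)

end CoefficientMaps

section Additive

variable {R : Type*} [CommRing R] {G : Type*} [Group G] {H K : Subgroup G} {t : G → R}

theorem additive_one (ht : ∀ g ∈ H, ∀ h ∈ H, t (g * h) = t g + t h) : t 1 = 0 := by
  have := ht 1 H.one_mem 1 H.one_mem
  rw [mul_one] at this
  exact left_eq_add.1 this

theorem additive_inv (ht : ∀ g ∈ H, ∀ h ∈ H, t (g * h) = t g + t h) {g : G} (hg : g ∈ H) :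
    t g⁻¹ = -t g := by
  have := ht g⁻¹ (H.inv_mem hg) g hg
  rw [inv_mul_cancel, additive_one ht] at this
  exact eq_neg_of_add_eq_zero_left this.symm

theorem additive_zpow (ht : ∀ g ∈ H, ∀ h ∈ H, t (g * h) = t g + t h) {g : G} (hg : g ∈ H)
    (htg : t g = 1) (a : ℤ) : t (g ^ a) = a := by
  induction a with
  | zero => rw [zpow_zero, additive_one ht, Int.cast_zero]
  | succ n ih =>
    rw [zpow_add_one, ht _ (H.zpow_mem hg _) _ hg, ih, htg]
    push_cast; rfl
  | pred n ih =>
    rw [zpow_sub_one, ht _ (H.zpow_mem hg _) _ (H.inv_mem hg), ih, additive_inv ht hg, htg]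
    push_cast; ring

theorem additive_conj (ht : ∀ g ∈ H, ∀ h ∈ H, t (g * h) = t g + t h)
    (hK : ∀ h, h ∈ K ↔ h ∈ H ∧ t h = 0) (h : G) (hh : h ∈ H) (k : G) (hk : k ∈ K) :
    h⁻¹ * k * h ∈ K := by
  obtain ⟨hkH, hk0⟩ := (hK k).1 hk
  refine (hK _).2 ⟨H.mul_mem (H.mul_mem (H.inv_mem hh) hkH) hh, ?_⟩
  rw [ht _ (H.mul_mem (H.inv_mem hh) hkH) _ hh, ht _ (H.inv_mem hh) _ hkH, additive_inv ht hh, hk0]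
  ring

theorem le_cyclicFilt {M : ℕ → Subgroup G} (hM : IsNSeries M) {w : ℕ} (hw : 1 ≤ w)
    (ht : ∀ g ∈ H, ∀ h ∈ H, t (g * h) = t g + t h) (hK : ∀ h, h ∈ K ↔ h ∈ H ∧ t h = 0)
    {x : G} (hx : x ∈ H) (htx : t x = 1) {τ : G → ℤ} (hτ : ∀ g, (τ g : R) = t g)
    (hHM : H ≤ M w) (hMK : M (w + 1) ≤ K) (i : ℕ) : filt R M H i ≤ cyclicFilt R M K x w i := by
  refine cyclicFilt.filt_le hM hw hx (fun k hk => ((hK k).1 hk).1) hHM (inf_le_right.trans hMK)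
    (additive_conj ht hK) (fun h hh => ⟨τ h, (hK _).2 ⟨H.mul_mem (H.zpow_mem hx _) hh, ?_⟩⟩) i
  rw [ht _ (H.zpow_mem hx _) _ hh, additive_zpow ht hx htx, Int.cast_neg, hτ, neg_add_cancel]

end Additive

variable {G : Type*} [Group G] {M : ℕ → Subgroup G} {H K : Subgroup G}

theorem DimensionLE.int_step (hM : IsNSeries M) {n w : ℕ} (hw : 1 ≤ w) {t : G → ℤ}
    (ht : ∀ g ∈ H, ∀ h ∈ H, t (g * h) = t g + t h) (hK : ∀ h, h ∈ K ↔ h ∈ H ∧ t h = 0)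
    {x : G} (hx : x ∈ H) (htx : t x = 1) (hHM : H ≤ M w) (hMK : M (w + 1) ≤ K)
    (h : DimensionLE ℤ M n K) : DimensionLE ℤ M n H := by
  obtain ⟨c₀, hc₀⟩ := exists_linearMap_of (R := ℤ) fun g : G => of ℤ G (x ^ (-t g) * g)
  obtain ⟨c₁, hc₁⟩ := exists_linearMap_of (R := ℤ) fun g : G => t g • of ℤ G (x ^ (-t g) * g)
  have htz : ∀ a : ℤ, ∀ h ∈ (H : Set G), t (x ^ a * h) = t h + a := by
    intro a h hh
    rw [ht _ (H.zpow_mem hx a) h hh, additive_zpow ht hx htx, add_comm]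
    rfl
  refine DimensionLE.of_coeff (x := x) (t := t) (τ := t) (c₀ := c₀) (c₁ := c₁) hM hHM ?_ hc₁
    (additive_one ht) (fun h hh h0 => (hK h).2 ⟨hh, h0⟩) ?_ h
  · intro k hk
    rw [hc₀, ((hK k).1 hk).2, neg_zero, zpow_zero, one_mul]
  intro i z hz
  have hz' := le_cyclicFilt hM hw ht hK hx htx (τ := t) (fun g => Int.cast_id) hHM hMK i hz
  clear hz
  induction hz' using Submodule.span_induction with
  | mem z hz =>
    obtain ⟨a, j, δ, hδ, rfl⟩ := hz
    obtain ⟨h1, h2, h3⟩ := coeff_pow_sub_one_mul (M := M) (P := fun _ => (H : Set G))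
      (B := j + 1) hc₀ hc₁ (fun k hk => ((hK k).1 hk).1) (fun _ => le_rfl)
      (fun j _ h hh => ⟨H.mul_mem hx hh, by simpa using htz 1 h hh, by simpa using htz 1 h hh⟩)
      (fun k hk => ((hK k).1 hk).2) (fun k hk => ((hK k).1 hk).2) hδ (Nat.lt_succ_self j)
    obtain ⟨h4, h5⟩ := coeff_zpow_mul hc₀ hc₁ (htz a) (htz a) h1
    rw [h4, h5, h2, h3]
    rcases j with _ | _ | j
    · rw [Nat.zero_mul, Nat.sub_zero] at hδ
      simp only [if_true, zero_ne_one, if_false, zero_add]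
      exact ⟨hδ, anti (Nat.sub_le _ _) (Submodule.smul_mem _ _ hδ)⟩
    · simpa using hδ
    · simp
  | zero => simp
  | add y z _ _ hy hz =>
    rw [map_add, map_add]
    exact ⟨Submodule.add_mem _ hy.1 hz.1, Submodule.add_mem _ hy.2 hz.2⟩
  | smul r z _ hz =>
    rw [map_smul, map_smul]
    exact ⟨Submodule.smul_mem _ _ hz.1, Submodule.smul_mem _ _ hz.2⟩

section ZMod

variable {p : ℕ} [hp : Fact p.Prime]

theorem of_sub_one_pow_prime (x : G) : (of (ZMod p) G x - 1) ^ p = of (ZMod p) G (x ^ p) - 1 := by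
  have : CharP (MonoidAlgebra (ZMod p) G) p :=
    charP_of_injective_algebraMap (algebraMap (ZMod p) (MonoidAlgebra (ZMod p) G)).injective p
  rw [sub_pow_char_of_commute p (Commute.one_right _), one_pow, map_pow]

/-- In characteristic `p`, `(x - 1) ^ p = x ^ p - 1` belongs to the coefficients and has weight `p *
w`, so it can be absorbed into `δ` without loss. -/
theorem cyclicFilt_le_span_pow_lt {x : G} {w : ℕ} (hw : 1 ≤ w) (hM : IsNSeries M)
    (hxK : x ^ p ∈ K) (hxM : x ^ p ∈ M (p * w)) (i : ℕ) :
    cyclicFilt (ZMod p) M K x w i ≤ Submodule.span (ZMod p)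
      {z | ∃ j < p, ∃ δ ∈ filt (ZMod p) M K (i - j * w), (of (ZMod p) G x - 1) ^ j * δ = z} := by
  let V : ℕ → Submodule (ZMod p) (MonoidAlgebra (ZMod p) G) := fun i => Submodule.span (ZMod p)
    {z | ∃ j < p, ∃ δ ∈ filt (ZMod p) M K (i - j * w), (of (ZMod p) G x - 1) ^ j * δ = z}
  have h1 : ∀ j δ i, δ ∈ filt (ZMod p) M K (i - j * w) → (of (ZMod p) G x - 1) ^ j * δ ∈ V i := by
    intro j
    induction j using Nat.strong_induction_on with
    | _ j ih =>
      intro δ i hδ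
      rcases Nat.lt_or_ge j p with hj | hj
      · exact Submodule.subset_span ⟨j, hj, δ, hδ, rfl⟩
      · obtain ⟨l, rfl⟩ := Nat.exists_eq_add_of_le' hj
        rw [pow_add, mul_assoc, of_sub_one_pow_prime]
        refine ih l (by have := hp.out.pos; omega) _ i ?_
        have h2 : of (ZMod p) G (x ^ p) - 1 ∈ filt (ZMod p) M K (p * w) :=
          of_sub_one_mem (Nat.mul_pos hp.out.pos hw) hxK hxM
        refine anti ?_ (mul_mem h2 hδ)
        rw [add_mul]; omega
  have h2 : ∀ z ∈ V i, of (ZMod p) G x * z ∈ V i := by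
    intro z hz
    have h3 : V i ≤ (V i).comap (LinearMap.mulLeft (ZMod p) (of (ZMod p) G x)) := by
      refine Submodule.span_le.2 ?_
      rintro _ ⟨j, -, δ, hδ, rfl⟩
      change of (ZMod p) G x * ((of (ZMod p) G x - 1) ^ j * δ) ∈ V i
      have h4 : of (ZMod p) G x * ((of (ZMod p) G x - 1) ^ j * δ) =
          (of (ZMod p) G x - 1) ^ (j + 1) * δ + (of (ZMod p) G x - 1) ^ j * δ := by
        rw [pow_succ', mul_assoc, sub_mul _ (1 : MonoidAlgebra (ZMod p) G), one_mul,
          sub_add_cancel]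
      rw [h4]
      exact Submodule.add_mem _ (h1 _ _ _ (anti (by rw [Nat.succ_mul]; omega) hδ)) (h1 _ _ _ hδ)
    exact h3 hz
  refine Submodule.span_le.2 ?_
  rintro _ ⟨a, j, δ, hδ, rfl⟩
  -- Division of `a` by `p`: the power of `x ^ p` is absorbed into `δ`, and the remaining factors `x
  -- = (x - 1) + 1` preserve the span.
  have h3 : of (ZMod p) G (x ^ a) * ((of (ZMod p) G x - 1) ^ j * δ) =
      of (ZMod p) G x ^ (a % p).toNat *
        ((of (ZMod p) G x - 1) ^ j * (of (ZMod p) G ((x ^ p) ^ (a / p)) * δ)) := by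
    have h4 : x ^ a = x ^ (a % p).toNat * (x ^ p) ^ (a / p) := by
      rw [← zpow_natCast, Int.toNat_of_nonneg
        (Int.emod_nonneg _ (by exact_mod_cast hp.out.ne_zero)), ← zpow_natCast x p, ← zpow_mul,
        ← zpow_add, Int.emod_add_mul_ediv]
    have h5 : Commute (of (ZMod p) G ((x ^ p) ^ (a / p))) ((of (ZMod p) G x - 1) ^ j) := by
      refine Commute.pow_right (Commute.sub_right ?_ (Commute.one_right _)) j
      exact (((Commute.refl x).pow_left p).zpow_left _).map (of (ZMod p) G)
    rw [h4, map_mul, map_pow, mul_assoc, ← mul_assoc (of (ZMod p) G ((x ^ p) ^ (a / p))), h5.eq,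
      mul_assoc]
  rw [h3]
  have h4 : of (ZMod p) G ((x ^ p) ^ (a / p)) * δ ∈ filt (ZMod p) M K (i - j * w) := by
    have := mul_mem (of_mem (R := ZMod p) hM (K.zpow_mem hxK (a / p))) hδ
    rwa [zero_add] at this
  generalize (a % p).toNat = r
  induction r with
  | zero => rw [pow_zero, one_mul]; exact h1 _ _ _ h4
  | succ r ih => rw [pow_succ', mul_assoc]; exact h2 _ ih

theorem DimensionLE.zmod_step (hM : IsNSeries M)
    (hMp : ∀ i, 1 ≤ i → ∀ x ∈ M i, x ^ p ∈ M (p * i)) {n w : ℕ} (hw : 1 ≤ w) {t : G → ZMod p}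
    (ht : ∀ g ∈ H, ∀ h ∈ H, t (g * h) = t g + t h) (hK : ∀ h, h ∈ K ↔ h ∈ H ∧ t h = 0)
    {x : G} (hx : x ∈ H) (htx : t x = 1) (hHM : H ≤ M w) (hMK : M (w + 1) ≤ K)
    (h : DimensionLE (ZMod p) M n K) : DimensionLE (ZMod p) M n H := by
  obtain ⟨c₀, hc₀⟩ := exists_linearMap_of (R := ZMod p)
    fun g : G => of (ZMod p) G (x ^ (-((t g).val : ℤ)) * g)
  obtain ⟨c₁, hc₁⟩ := exists_linearMap_of (R := ZMod p)
    fun g : G => t g • of (ZMod p) G (x ^ (-((t g).val : ℤ)) * g)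
  have hxM : x ^ p ∈ M (p * w) := hMp w hw x (hHM hx)
  have hxK : x ^ p ∈ K := hMK (hM.le_of_le (by omega) (by have := hp.out.two_le; nlinarith) hxM)
  refine DimensionLE.of_coeff (x := x) (t := t) (τ := fun g => ((t g).val : ℤ)) (c₀ := c₀)
    (c₁ := c₁) hM hHM ?_ hc₁ (additive_one ht) (fun h hh h0 => (hK h).2 ⟨hh, h0⟩) ?_ h
  · intro k hk
    rw [hc₀, ((hK k).1 hk).2, ZMod.val_zero, Nat.cast_zero, neg_zero, zpow_zero, one_mul]
  intro i z hz
  have hz' := cyclicFilt_le_span_pow_lt hw hM hxK hxM i (le_cyclicFilt hM hw ht hK hx htx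
    (τ := fun g => ((t g).val : ℤ)) (fun g => by simp) hHM hMK i hz)
  clear hz
  induction hz' using Submodule.span_induction with
  | mem z hz =>
    obtain ⟨j, hj, δ, hδ, rfl⟩ := hz
    -- As long as `j + 1 < p`, adding `1` to the coordinate causes no wraparound in `ZMod.val`.
    have hx1 : ∀ j, j + 1 < p → ∀ h ∈ {h : G | h ∈ H ∧ (t h).val ≤ j},
        x * h ∈ {h : G | h ∈ H ∧ (t h).val ≤ j + 1} ∧
          ((t (x * h)).val : ℤ) = (t h).val + 1 ∧ t (x * h) = t h + 1 := by
      rintro j hj h ⟨hh, hhj⟩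
      have h1 : t (x * h) = t h + 1 := by rw [ht x hx h hh, htx, add_comm]
      have h2 : (t (x * h)).val = (t h).val + 1 := by
        have : Fact (1 < p) := ⟨hp.out.one_lt⟩
        rw [h1, ZMod.val_add_of_lt, ZMod.val_one]
        rw [ZMod.val_one]; omega
      refine ⟨⟨H.mul_mem hx hh, by rw [h2]; omega⟩, by rw [h2]; push_cast; rfl, h1⟩
    obtain ⟨-, h2, h3⟩ := coeff_pow_sub_one_mul (M := M) (τ := fun g => ((t g).val : ℤ))
      (P := fun j => {h : G | h ∈ H ∧ (t h).val ≤ j}) (B := p) hc₀ hc₁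
      (fun k hk => ⟨((hK k).1 hk).1, by rw [((hK k).1 hk).2, ZMod.val_zero]⟩)
      (fun j h hh => ⟨hh.1, hh.2.trans (Nat.le_succ j)⟩) hx1
      (fun k hk => by rw [((hK k).1 hk).2, ZMod.val_zero, Nat.cast_zero])
      (fun k hk => ((hK k).1 hk).2) hδ hj
    rw [h2, h3]
    rcases j with _ | _ | j
    · rw [Nat.zero_mul, Nat.sub_zero] at hδ
      simpa using hδ
    · simpa using hδ
    · simp
  | zero => simp
  | add y z _ _ hy hz =>
    rw [map_add, map_add]
    exact ⟨Submodule.add_mem _ hy.1 hz.1, Submodule.add_mem _ hy.2 hz.2⟩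
  | smul r z _ hz =>
    rw [map_smul, map_smul]
    exact ⟨Submodule.smul_mem _ _ hz.1, Submodule.smul_mem _ _ hz.2⟩

end ZMod

/-- The chain from `B` to `A` consists of the subgroups `U j` on which the coordinates with index at
least `j` vanish. -/
theorem induction_coordinates {R : Type*} [CommRing R] {A B : Subgroup G} (hBA : B ≤ A)
    {S : Subgroup G → Prop}
    (hS : ∀ (H K : Subgroup G) (t : G → R) (x : G), (∀ g ∈ H, ∀ h ∈ H, t (g * h) = t g + t h) →
      (∀ h, h ∈ K ↔ h ∈ H ∧ t h = 0) → x ∈ H → t x = 1 → H ≤ A → B ≤ K → S K → S H)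
    {s : ℕ} {ψ : G → Fin s → R} (hψ : ∀ x ∈ A, ∀ y ∈ A, ψ (x * y) = ψ x + ψ y)
    (hψB : ∀ x ∈ A, ψ x = 0 ↔ x ∈ B) (hψs : ∀ v, ∃ x ∈ A, ψ x = v) (hB : S B) : S A := by
  have hadd : ∀ l : Fin s, ∀ g ∈ A, ∀ h ∈ A, ψ (g * h) l = ψ g l + ψ h l :=
    fun l g hg h hh => congrFun (hψ g hg h hh) l
  let U : ℕ → Subgroup G := fun j =>
    { carrier := {h | h ∈ A ∧ ∀ l : Fin s, j ≤ l → ψ h l = 0}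
      one_mem' := ⟨A.one_mem, fun l _ => additive_one (t := fun g => ψ g l) (hadd l)⟩
      mul_mem' := fun {g h} hg hh => ⟨A.mul_mem hg.1 hh.1, fun l hl => by
        rw [hadd l g hg.1 h hh.1, hg.2 l hl, hh.2 l hl, add_zero]⟩
      inv_mem' := fun {g} hg => ⟨A.inv_mem hg.1, fun l hl => by
        rw [additive_inv (t := fun g => ψ g l) (hadd l) hg.1, hg.2 l hl, neg_zero]⟩ }
  have hU : ∀ j h, h ∈ U j ↔ h ∈ A ∧ ∀ l : Fin s, j ≤ l → ψ h l = 0 := fun j h => Iff.rfl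
  have hBU : ∀ j, B ≤ U j := fun j b hb =>
    (hU j b).2 ⟨hBA hb, fun l _ => congrFun ((hψB b (hBA hb)).2 hb) l⟩
  have key : ∀ j ≤ s, S (U j) := by
    intro j
    induction j with
    | zero =>
      intro _
      have : U 0 = B := le_antisymm
        (fun h hh => (hψB h hh.1).1 (funext fun l => hh.2 l (Nat.zero_le _))) (hBU 0)
      rwa [this]
    | succ j ih =>
      intro hj
      obtain ⟨x, hxA, hx⟩ := hψs (Pi.single ⟨j, hj⟩ 1)
      refine hS (U (j + 1)) (U j) (fun h => ψ h ⟨j, hj⟩) x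
        (fun g hg h hh => hadd _ g hg.1 h hh.1) (fun h => ⟨fun hh => ?_, fun hh => ?_⟩)
        ((hU _ _).2 ⟨hxA, fun l hl => ?_⟩) (by simp [hx]) (fun h hh => hh.1) (hBU j)
        (ih (by omega))
      · exact ⟨⟨hh.1, fun l hl => hh.2 l (by omega)⟩, hh.2 ⟨j, hj⟩ le_rfl⟩
      · refine ⟨hh.1.1, fun l hl => ?_⟩
        rcases hl.eq_or_lt with h1 | h1
        · obtain rfl : l = ⟨j, hj⟩ := Fin.ext h1.symm
          exact hh.2
        · exact hh.1.2 l h1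
      · rw [hx, Pi.single_apply, if_neg]
        rintro rfl
        simp at hl
  have h1 : U s = A := le_antisymm (fun h hh => hh.1)
    fun h hh => ⟨hh, fun l hl => absurd l.2 (by omega)⟩
  rw [← h1]
  exact key s le_rfl

theorem DimensionLE.top {R : Type*} [CommRing R] (hM : IsNSeries M) {n : ℕ} (hn : 1 ≤ n)
    (hS : ∀ w, 1 ≤ w → DimensionLE R M n (M (w + 1)) → DimensionLE R M n (M w)) :
    DimensionLE R M n ⊤ := by
  have h1 : ∀ k, k < n → DimensionLE R M n (M (n - k)) := by
    intro k
    induction k with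
    | zero => exact fun _ i hi hin h hh _ => hM.le_of_le hi hin hh
    | succ k ih =>
      intro hk
      refine hS _ (by omega) ?_
      rw [show n - (k + 1) + 1 = n - k by omega]
      exact ih (by omega)
  have h2 := h1 (n - 1) (by omega)
  rwa [show n - (n - 1) = 1 by omega, hM.one_eq_top] at h2

theorem dimensionLE_int (hM : IsNSeries M) [Group.FG G] [Group.IsNilpotent G]
    (hMt : ∀ i, 1 ≤ i → ∀ x, ∀ k, 0 < k → x ^ k ∈ M i → x ∈ M i) {n : ℕ} (hn : 1 ≤ n) :
    DimensionLE ℤ M n ⊤ := by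
  refine DimensionLE.top hM hn fun w hw hS => ?_
  obtain ⟨s, ψ, h1, h2, h3⟩ := Subgroup.exists_int_coordinates (hM.commutator_self_le hw)
    (Subgroup.fg_of_isNilpotent (M w)) (fun x _ k hk h => hMt _ (by omega) x k hk h)
  exact induction_coordinates (hM.succ_le w hw)
    (fun H K t x ht hK hx htx hHM hMK => DimensionLE.int_step hM hw ht hK hx htx hHM hMK) h1 h2 h3 hS

theorem dimensionLE_zmod (hM : IsNSeries M) [Group.FG G] [Group.IsNilpotent G] {p : ℕ}
    [hp : Fact p.Prime] (hMp : ∀ i, 1 ≤ i → ∀ x ∈ M i, x ^ p ∈ M (p * i)) {n : ℕ} (hn : 1 ≤ n) :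
    DimensionLE (ZMod p) M n ⊤ := by
  refine DimensionLE.top hM hn fun w hw hS => ?_
  obtain ⟨s, ψ, h1, h2, h3⟩ := Subgroup.exists_zmod_coordinates p (hM.commutator_self_le hw)
    (Subgroup.fg_of_isNilpotent (M w)) (fun x hx => hM.le_of_le (by omega)
      (by have := hp.out.two_le; nlinarith) (hMp w hw x hx))
  exact induction_coordinates (hM.succ_le w hw) (fun H K t x ht hK hx htx hHM hMK =>
    DimensionLE.zmod_step hM hMp hw ht hK hx htx hHM hMK) h1 h2 h3 hS

end filt

/-! ### Comparison of the series and conclusion. -/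

theorem nSeriesFiltration_le_filt {R : Type*} [CommRing R] {G : Type*} [Group G]
    {N M : ℕ → Subgroup G} (hNM : ∀ i, 1 ≤ i → N i ≤ M i) {i j : ℕ} (hij : i ≤ j) :
    nSeriesFiltration R N j ≤ filt R M ⊤ i := by
  refine Submodule.span_le.2 ?_
  rintro _ ⟨l, -, hl, hj, rfl⟩
  exact Submodule.subset_span
    ⟨l, fun q hq => ⟨(hl q hq).1, Subgroup.mem_top _, hNM _ (hl q hq).1 (hl q hq).2⟩,
      hij.trans hj, rfl⟩

theorem dimensionSubgroup_int_le (R : Type*) [CommRing R] {G : Type*} [Group G]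
    {N : ℕ → Subgroup G} (hN : IsNSeries N) (i : ℕ) :
    dimensionSubgroup ℤ hN i ≤ dimensionSubgroup R hN i := by
  obtain ⟨f, hf⟩ : ∃ f : MonoidAlgebra ℤ G →+* MonoidAlgebra R G,
      ∀ g, f (MonoidAlgebra.of ℤ G g) = MonoidAlgebra.of R G g :=
    ⟨(MonoidAlgebra.lift ℤ (MonoidAlgebra R G) G (MonoidAlgebra.of R G)).toRingHom,
      fun g => MonoidAlgebra.lift_of _ g⟩
  have h1 : ∀ z ∈ nSeriesFiltration ℤ N i, f z ∈ nSeriesFiltration R N i := by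
    intro z hz
    unfold nSeriesFiltration at hz
    induction hz using Submodule.span_induction with
    | mem z hz =>
      obtain ⟨l, hne, hl, hi, rfl⟩ := hz
      refine Submodule.subset_span ⟨l, hne, hl, hi, ?_⟩
      rw [map_list_prod, List.map_map]
      congr 1
      refine List.map_congr_left fun q _ => ?_
      rw [Function.comp_apply, map_sub, hf, map_one]
    | zero => rw [map_zero]; exact Submodule.zero_mem _
    | add y z _ _ hy hz => rw [map_add]; exact Submodule.add_mem _ hy hz
    | smul a z _ hz => rw [map_zsmul]; exact zsmul_mem hz a
  intro g hg
  have h2 := h1 _ hg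
  rwa [map_sub, hf, map_one] at h2

theorem exists_pow_eq_one_of_mem_dimensionSubgroup {G : Type*} [Group G] [Group.FG G]
    {N : ℕ → Subgroup G} (hN : IsNSeries N) {d n : ℕ} (hd : N (d + 1) = ⊥) (hn : d + 1 ≤ n)
    {g : G} (hg : g ∈ dimensionSubgroup ℤ hN n) : ∃ k, 0 < k ∧ g ^ k = 1 := by
  have := hN.isNilpotent hd
  obtain ⟨M, hM, hMN⟩ := hN.exists_isolator
  have h1 : filt.DimensionLE ℤ M (d + 1) ⊤ := by
    refine filt.dimensionLE_int hM (fun i hi x k hk hx => ?_) (by omega)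
    obtain ⟨l, hl, hlx⟩ := (hMN i hi _).1 hx
    exact (hMN i hi x).2 ⟨k * l, Nat.mul_pos hk hl, by rwa [pow_mul]⟩
  have h2 := h1 (d + 1) (by omega) le_rfl g (Subgroup.mem_top g) (nSeriesFiltration_le_filt
    (fun i hi x hx => (hMN i hi x).2 ⟨1, one_pos, by rwa [pow_one]⟩) hn hg)
  obtain ⟨k, hk, h3⟩ := (hMN _ (by omega) g).1 h2
  rw [hd, Subgroup.mem_bot] at h3
  exact ⟨k, hk, h3⟩

theorem mem_pSeries_of_mem_dimensionSubgroup {G : Type*} [Group G] [Group.FG G]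
    {N : ℕ → Subgroup G} (hN : IsNSeries N) {d n : ℕ} (hd : N (d + 1) = ⊥) (hn : 1 ≤ n) {p : ℕ}
    (hp : p.Prime) {g : G} (hg : g ∈ dimensionSubgroup ℤ hN n) :
    g ∈ pSeries N p (1 + Nat.clog p n) 1 := by
  have := hN.isNilpotent hd
  have : Fact p.Prime := ⟨hp⟩
  have h1 := filt.dimensionLE_zmod (pSeries.isNSeries_clog hN hd hp.one_lt)
    (fun i _ x hx => pSeries.pow_mem_clog hN hd hp.one_lt hx) hn
  exact h1 n hn le_rfl g (Subgroup.mem_top g)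
    (nSeriesFiltration_le_filt (fun i hi => pSeries.le_clog hp.one_lt hi) le_rfl
      (dimensionSubgroup_int_le (ZMod p) hN n hg))

theorem eq_one_of_mem_dimensionSubgroup {G : Type*} [Group G] [Group.FG G]
    {N : ℕ → Subgroup G} (hN : IsNSeries N) {d n e p : ℕ} (hd : N (d + 1) = ⊥) (hp : p.Prime)
    (he : ∀ x : G, (∃ k : ℕ, x ^ p ^ k = 1) → x ^ p ^ e = 1) (hn : (p ^ e) ^ d * (d + 1) ≤ n)
    {g : G} (hg : g ∈ dimensionSubgroup ℤ hN n) (hgp : g ^ p = 1) : g = 1 := by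
  rcases Nat.eq_zero_or_pos e with rfl | hepos
  · simpa using he g ⟨1, by rwa [pow_one]⟩
  rcases Nat.eq_zero_or_pos d with rfl | hdpos
  · have h1 : g ∈ N 1 := by rw [hN.one_eq_top]; exact Subgroup.mem_top g
    rwa [hd, Subgroup.mem_bot] at h1
  have h1 : 0 < (p ^ e) ^ d := pow_pos (pow_pos hp.pos _) _
  have hlt : p ^ (e * d) < n := by rw [pow_mul]; nlinarith
  have h2 := (Nat.lt_clog_iff_pow_lt hp.one_lt).2 hlt
  -- Here `clog p n ≥ e * d + 1 ≥ e + d`, the last step being `(e - 1) * (d - 1) ≥ 0`; hence the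
  -- separate cases `e = 0` and `d = 0`.
  have h3 : d + 1 + e ≤ 1 + Nat.clog p n := by
    have : e + d ≤ e * d + 1 := by nlinarith
    omega
  have h4 := pSeries.anti h3 le_rfl
    (mem_pSeries_of_mem_dimensionSubgroup hN hd (by omega) hp hg)
  -- The base index is `d + 1` rather than `d` so that it is at least `2` even when `d = 1`.
  obtain ⟨z, -, rfl⟩ := pSeries.exists_eq_pow hN hd (Nat.le_succ d) (by omega) e h4
  exact he z ⟨e + 1, by rw [pow_succ, pow_mul]; exact hgp⟩

theorem exists_pExponent_eq {G : Type*} [Group G] {E : ℕ} (hE : 0 < E)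
    (hG : ∀ x : G, (∃ k, 0 < k ∧ x ^ k = 1) → x ^ E = 1) {p : ℕ} (hp : p.Prime) :
    ∃ e : ℕ, pExponent G p = e ∧ (∀ x : G, (∃ k : ℕ, x ^ p ^ k = 1) → x ^ p ^ e = 1) ∧
      p ^ e ≤ E := by
  classical
  have h1 : ∀ x : G, (∃ k : ℕ, x ^ p ^ k = 1) → x ^ p ^ E.factorization p = 1 := by
    rintro x ⟨k, hk⟩
    have h2 := hG x ⟨_, pow_pos hp.pos k, hk⟩
    obtain ⟨j, -, hj⟩ := (Nat.dvd_prime_pow hp).1 (orderOf_dvd_of_pow_eq_one hk)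
    have h3 := orderOf_dvd_of_pow_eq_one h2
    rw [hj] at h3
    rw [← orderOf_dvd_iff_pow_eq_one, hj]
    exact pow_dvd_pow p ((hp.pow_dvd_iff_le_factorization hE.ne').1 h3)
  have hex : ∃ e : ℕ, ∀ x : G, (∃ k : ℕ, x ^ p ^ k = 1) → x ^ p ^ e = 1 := ⟨_, h1⟩
  refine ⟨Nat.find hex, le_antisymm (iInf₂_le _ (Nat.find_spec hex))
    (le_iInf₂ fun e he => Nat.cast_le.2 (Nat.find_min' hex he)), Nat.find_spec hex, ?_⟩
  exact (Nat.pow_le_pow_right hp.pos (Nat.find_min' hex h1)).trans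
    (Nat.le_of_dvd hE (Nat.ordProj_dvd E p))

theorem mainTheorem6 {G : Type*} [Group G] [Group.FG G] {N : ℕ → Subgroup G} (hN : IsNSeries N)
    (d : ℕ) (hd : N (d + 1) = ⊥) :
    ∃ m : ℕ,
      IsGreatest {a : ℕ∞ | ∃ p : ℕ, p.Prime ∧ a = (p : ℕ∞) ^ pExponent G p} (m : ℕ∞) ∧
      dimensionSubgroup ℤ hN (m ^ d * (d + 1)) = ⊥ := by
  have := hN.isNilpotent hd
  obtain ⟨E, hE, hG⟩ := exists_forall_pow_eq_one_of_isNilpotent G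
  have h1 : ∀ p : ℕ, ∃ e : ℕ, p.Prime → pExponent G p = e ∧
      (∀ x : G, (∃ k : ℕ, x ^ p ^ k = 1) → x ^ p ^ e = 1) ∧ p ^ e ≤ E := by
    intro p
    by_cases hp : p.Prime
    · obtain ⟨e, he⟩ := exists_pExponent_eq hE hG hp
      exact ⟨e, fun _ => he⟩
    · exact ⟨0, fun h => absurd h hp⟩
  choose e he using h1
  have hcast : ∀ p : ℕ, p.Prime → (p : ℕ∞) ^ pExponent G p = ((p ^ e p : ℕ) : ℕ∞) := by
    intro p hp
    rw [(he p hp).1, ENat.epow_natCast, Nat.cast_pow]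
  have hne : {a : ℕ | ∃ p : ℕ, p.Prime ∧ a = p ^ e p}.Nonempty := ⟨_, 2, Nat.prime_two, rfl⟩
  have hbdd : BddAbove {a : ℕ | ∃ p : ℕ, p.Prime ∧ a = p ^ e p} := by
    refine ⟨E, ?_⟩
    rintro _ ⟨p, hp, rfl⟩
    exact (he p hp).2.2
  set m := sSup {a : ℕ | ∃ p : ℕ, p.Prime ∧ a = p ^ e p}
  have hle : ∀ p : ℕ, p.Prime → p ^ e p ≤ m := fun p hp => le_csSup hbdd ⟨p, hp, rfl⟩
  refine ⟨m, ⟨?_, ?_⟩, ?_⟩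
  · obtain ⟨p, hp, hmp⟩ := Nat.sSup_mem hne hbdd
    exact ⟨p, hp, by rw [hcast p hp, ← hmp]⟩
  · rintro _ ⟨p, hp, rfl⟩
    rw [hcast p hp]
    exact Nat.cast_le.2 (hle p hp)
  · rw [eq_bot_iff]
    intro g hg
    rw [Subgroup.mem_bot]
    have hmpos : 0 < m := (pow_pos two_pos _).trans_le (hle 2 Nat.prime_two)
    have hn : d + 1 ≤ m ^ d * (d + 1) := Nat.le_mul_of_pos_left _ (pow_pos hmpos d)
    obtain ⟨k, hk, hgk⟩ := exists_pow_eq_one_of_mem_dimensionSubgroup hN hd hn hg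
    by_contra hg1
    obtain ⟨p, hp, hpg⟩ := Nat.exists_prime_and_dvd (mt orderOf_eq_one_iff.1 hg1)
    have hpos : 0 < orderOf g := orderOf_pos_iff.2 (isOfFinOrder_iff_pow_eq_one.2 ⟨k, hk, hgk⟩)
    -- This power is killed by `p`, so it is trivial, contradicting the minimality of the order of
    -- `g`.
    have h2 : g ^ (orderOf g / p) = 1 := by
      refine eq_one_of_mem_dimensionSubgroup hN hd hp (he p hp).2.1
        (Nat.mul_le_mul_right _ (Nat.pow_le_pow_left (hle p hp) d)) (Subgroup.pow_mem _ hg _) ?_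
      rw [← pow_mul, Nat.div_mul_cancel hpg, pow_orderOf_eq_one]
    have h3 := Nat.le_of_dvd (Nat.div_pos (Nat.le_of_dvd hpos hpg) hp.pos)
      (orderOf_dvd_of_pow_eq_one h2)
    exact absurd h3 (not_le.2 (Nat.div_lt_self hpos hp.one_lt))
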